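/- Let $H$ be a complex Hilbert space with inner product $\langle\cdot,\cdot\rangle$ and let $A:\mathfrak D(A)\subset H\to H$ be a strictly positive self-adjoint operator with compact inverse. Let $\alpha,\beta,a,\eta,\varphi\in\mathbb R$ with $\alpha>0$, $\beta>\alpha$, $a\neq 0$ and $0\le\varphi\le 1$. Let $\mathbb H=\mathfrak D(A^{1/2})\times\mathfrak D(A^{1/2})\times H\times H$, a Hilbert space with the norm $$\|(u,v,w,\theta)\|_{\mathbb H}^2=a^2\alpha(\beta-\alpha)\|A^{1/2}v\|^2+a^2\|A^{1/2}u+\alpha A^{1/2}v\|^2+\|v+\alpha w\|^2+\|\theta\|^2$$ and the inner product inducing it. Let $\mathbb B$ be the operator on $\mathbb H$ with domain $$\mathfrak D(\mathbb B)=\{(u,v,w,\theta)\in\mathbb H:\ v,w\in\mathfrak D(A^{1/2}),\ a^2u+a^2\beta v-\eta A^{\varphi-1}\theta\in\mathfrak D(A),\ \eta A^{\varphi-1}v+\alpha\eta A^{\varphi-1}w+\theta\in\mathfrak D(A)\}$$ given by $$\mathbb B(u,v,w,\theta)=\Big(v,\ w,\ -\tfrac1\alpha\big[A(a^2u+a^2\beta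 v-\eta A^{\varphi-1}\theta)+w\big],\ -A(\eta A^{\varphi-1}v+\alpha\eta A^{\varphi-1}w+\theta)\Big).$$ Then $\mathbb B$ is densely defined and dissipative, $0\in\rho(\mathbb B)$, and $\mathbb B$ is the infinitesimal generator of a $C_0$-semigroup of contractions $(S(t))_{t\ge0}$ on $\mathbb H$. For every $U_0\in\mathbb H$ there is a unique weak solution $U\in C([0,\infty),\mathbb H)$ of $\frac{d}{dt}U(t)=\mathbb BU(t)$, $U(0)=U_0$ (that is, for every $V\in\mathfrak D(\mathbb B^*)$ the function $t\mapsto\langle U(t),V\rangle_{\mathbb H}$ is differentiable on $[0,\infty)$ with derivative $\langle U(t),\mathbb B^*V\rangle_{\mathbb H}$), and $U(t)=S(t)U_0$. Furthermore, if $k\in\mathbb N$ and $U_0\in\mathfrak D(\mathbb B^k)$, then $$U\in\bigcap_{j=0}^kC^{k-j}\big([0,\infty),\mathfrak D(\mathbb B^j)\big),$$ where $\mathfrak D(\mathbb B^j)$ carries the graph norm of $\mathbb B^j$. -/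

import Mathlib

open scoped NNReal Topology InnerProductSpace LinearPMap

noncomputable section

namespace MGTFourier

/-! ### Unbounded operators on a complex Hilbert space -/

section Operators

variable {E : Type*} [NormedAddCommGroup E] [InnerProductSpace ℂ E]

/-- `T` is an everywhere defined bounded two-sided inverse of the (unbounded) operator `A`. -/
structure IsBoundedInverse (A : E →ₗ.[ℂ] E) (T : E →L[ℂ] E) : Prop where
  left_inv : ∀ x : A.domain, T (A x) = x
  right_inv : ∀ y : E, ∃ h : T y ∈ A.domain, A ⟨T y, h⟩ = y

open scoped Classical in
/-- The bounded operator `A⁻¹` (and `0` if `A` has no bounded inverse). -/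
def boundedInverse (A : E →ₗ.[ℂ] E) : E →L[ℂ] E :=
  if h : ∃ T, IsBoundedInverse A T then h.choose else 0

lemma boundedInverse_spec {A : E →ₗ.[ℂ] E} (h : ∃ T, IsBoundedInverse A T) :
    IsBoundedInverse A (boundedInverse A) := by
  rw [boundedInverse, dif_pos h]
  exact h.choose_spec

/-- The resolvent set of an operator: those `z` for which `z - A` is a bijection of the domain
of `A` onto the space, with bounded inverse. -/
def resolventSet (A : E →ₗ.[ℂ] E) : Set ℂ :=
  {z | ∃ R : E →L[ℂ] E, (∀ x : A.domain, R (z • (x : E) - A x) = x) ∧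
    ∀ y : E, ∃ h : R y ∈ A.domain, z • R y - A ⟨R y, h⟩ = y}

/-- Dissipativity: `Re ⟨A x, x⟩ ≤ 0` on the domain of `A`. -/
def IsDissipative (A : E →ₗ.[ℂ] E) : Prop :=
  ∀ x : A.domain, (inner ℂ (A x) (x : E)).re ≤ 0

/-- The composition `S T`, with domain `{x ∈ D(T) | T x ∈ D(S)}`. -/
def opComp (S T : E →ₗ.[ℂ] E) : E →ₗ.[ℂ] E where
  domain :=
    { carrier := {x | ∃ hx : x ∈ T.domain, T ⟨x, hx⟩ ∈ S.domain}
      zero_mem' := ⟨T.domain.zero_mem, by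
        have : T ⟨0, T.domain.zero_mem⟩ = 0 := LinearPMap.map_zero T
        rw [this]
        exact S.domain.zero_mem⟩
      add_mem' := fun {x y} ⟨hx, hx'⟩ ⟨hy, hy'⟩ => ⟨T.domain.add_mem hx hy, by
        have : T ⟨x + y, T.domain.add_mem hx hy⟩ = T ⟨x, hx⟩ + T ⟨y, hy⟩ :=
          LinearPMap.map_add T ⟨x, hx⟩ ⟨y, hy⟩
        rw [this]
        exact S.domain.add_mem hx' hy'⟩
      smul_mem' := fun c x ⟨hx, hx'⟩ => ⟨T.domain.smul_mem c hx, by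
        have : T ⟨c • x, T.domain.smul_mem c hx⟩ = c • T ⟨x, hx⟩ :=
          LinearPMap.map_smul T c ⟨x, hx⟩
        rw [this]
        exact S.domain.smul_mem c hx'⟩ }
  toFun :=
    { toFun := fun x => S ⟨T ⟨x, x.2.1⟩, x.2.2⟩
      map_add' := fun x y => by
        rw [← LinearPMap.map_add]
        congr 1
        exact Subtype.ext (LinearPMap.map_add T ⟨x, x.2.1⟩ ⟨y, y.2.1⟩)
      map_smul' := fun c x => by
        rw [RingHom.id_apply, ← LinearPMap.map_smul]
        congr 1
        exact Subtype.ext (LinearPMap.map_smul T c ⟨x, x.2.1⟩) }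

/-- The powers `A⁰ = I`, `Aⁿ⁺¹ = Aⁿ A`, with
`D(Aⁿ⁺¹) = {x ∈ D(A) | A x ∈ D(Aⁿ)}`. -/
def opPow (A : E →ₗ.[ℂ] E) : ℕ → E →ₗ.[ℂ] E
  | 0 => (LinearMap.id : E →ₗ[ℂ] E).toPMap ⊤
  | n + 1 => opComp (opPow A n) A

/-- `U ∈ Cᵐ([0, ∞), D(A))`, where the domain `D(A)` carries the graph norm. The normed space
`D(A)` is represented by the graph of `A`, a subspace of `E × E`, through `x ↦ (x, A x)`. -/
def ContDiffInDomain (A : E →ₗ.[ℂ] E) (m : ℕ) (U : ℝ → E) : Prop :=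
  ∃ f : ℝ → A.graph, ContDiffOn ℝ m f (Set.Ici 0) ∧ ∀ t ∈ Set.Ici (0 : ℝ), (f t).1.1 = U t

/-- `S` is a strongly continuous semigroup of contractions. -/
structure IsC0ContractionSemigroup (S : ℝ≥0 → E →L[ℂ] E) : Prop where
  zero : S 0 = ContinuousLinearMap.id ℂ E
  add : ∀ s t, S (s + t) = (S s).comp (S t)
  tendsto_zero : ∀ x, Filter.Tendsto (fun t => S t x) (𝓝 0) (𝓝 x)
  contraction : ∀ t, ‖S t‖ ≤ 1

/-- `A` is the infinitesimal generator of `S`: `x ∈ D(A)` and `A x = y` if and only if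
`(S(t) x - x) / t → y` as `t → 0⁺`. -/
def IsGenerator (A : E →ₗ.[ℂ] E) (S : ℝ≥0 → E →L[ℂ] E) : Prop :=
  ∀ x y : E, (∃ hx : x ∈ A.domain, A ⟨x, hx⟩ = y) ↔
    Filter.Tendsto (fun t : ℝ≥0 => (t : ℝ)⁻¹ • (S t x - x)) (𝓝[>] 0) (𝓝 y)

/-- `U ∈ C([0, ∞), E)` is a weak solution of `U' = A U`, `U(0) = U₀`: for each `V` in the domain
of the adjoint `A†`, the function `t ↦ ⟨V, U(t)⟩` is differentiable on `[0, ∞)` with derivative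
`⟨A† V, U(t)⟩`. (Only the restriction of `U` to `[0, ∞)` matters.) -/
structure IsWeakSolution [CompleteSpace E] (A : E →ₗ.[ℂ] E) (U₀ : E) (U : ℝ → E) : Prop where
  continuousOn : ContinuousOn U (Set.Ici 0)
  initial : U 0 = U₀
  weak : ∀ V : A†.domain, ∀ t ∈ Set.Ici (0 : ℝ),
    HasDerivWithinAt (fun s => inner ℂ (V : E) (U s)) (inner ℂ (A† V) (U t)) (Set.Ici 0) t

end Operators

section Powers

variable {H : Type*} [NormedAddCommGroup H] [InnerProductSpace ℂ H] [CompleteSpace H]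

/-- The bounded operator `A⁻ˢ = (A⁻¹)ˢ`, `s ≥ 0`, for a strictly positive self-adjoint
operator `A`, through the continuous functional calculus of the bounded positive
operator `A⁻¹`. -/
def negPow (A : H →ₗ.[ℂ] H) (s : ℝ) : H →L[ℂ] H := boundedInverse A ^ s

/-- The operator `Aˢ = (A⁻ˢ)⁻¹`, `s ≥ 0`, with domain `D(Aˢ)` the range of `A⁻ˢ`, for a strictly
positive self-adjoint operator `A`. -/
def posPow (A : H →ₗ.[ℂ] H) (s : ℝ) : H →ₗ.[ℂ] H :=
  ((negPow A s : H →ₗ[ℂ] H).toPMap ⊤).inverse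

end Powers

/-! ### The system -/

/-- The data of the abstract system
`α u''' + u'' + a² A u + a² β A u' - η A^φ θ = 0`, `θ' + A θ + α η A^φ u'' + η A^φ u' = 0`:
a strictly positive self-adjoint operator `A` with compact inverse on the complex Hilbert space
`H`, and real constants. -/
structure System (H : Type*) [NormedAddCommGroup H] [InnerProductSpace ℂ H]
    [CompleteSpace H] where
  A : H →ₗ.[ℂ] H
  isSelfAdjoint : IsSelfAdjoint A
  strictlyPositive : ∃ c : ℝ, 0 < c ∧
    ∀ x : A.domain, c * ‖(x : H)‖ ^ 2 ≤ (inner ℂ (A x) (x : H)).re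
  compactInverse : ∃ T : H →L[ℂ] H, IsBoundedInverse A T ∧ IsCompactOperator T
  α : ℝ
  β : ℝ
  a : ℝ
  η : ℝ
  φ : ℝ
  α_pos : 0 < α
  α_lt_β : α < β
  a_ne_zero : a ≠ 0
  φ_nonneg : 0 ≤ φ
  φ_le_one : φ ≤ 1

namespace System

variable {H : Type*} [NormedAddCommGroup H] [InnerProductSpace ℂ H] [CompleteSpace H]
variable (D : System H)

/-- The operator `A^{1/2}`. -/
def sqrtA : H →ₗ.[ℂ] H := posPow D.A (1 / 2)

lemma inv_spec : IsBoundedInverse D.A (boundedInverse D.A) :=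
  boundedInverse_spec (D.compactInverse.imp fun _ h => h.1)

lemma A_symm (x y : D.A.domain) : inner ℂ (D.A x) (y : H) = inner ℂ (x : H) (D.A y) := by
  have hd := D.isSelfAdjoint.dense_domain
  have h := LinearPMap.adjoint_isFormalAdjoint hd
  rw [LinearPMap.isSelfAdjoint_def.1 D.isSelfAdjoint] at h
  exact h x y

lemma inv_nonneg : 0 ≤ boundedInverse D.A := by
  rw [ContinuousLinearMap.nonneg_iff_isPositive, ContinuousLinearMap.isPositive_iff_complex]
  intro y
  obtain ⟨h, hy⟩ := D.inv_spec.right_inv y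
  obtain ⟨c, hc, hpos⟩ := D.strictlyPositive
  have h1 := hpos ⟨_, h⟩
  have h2 := D.A_symm ⟨_, h⟩ ⟨_, h⟩
  rw [hy] at h1 h2
  have h3 : inner ℂ (boundedInverse D.A y) y =
      starRingEnd ℂ (inner ℂ (boundedInverse D.A y) y) := by
    rw [inner_conj_symm]; exact h2.symm
  refine ⟨?_, ?_⟩
  · exact (Complex.conj_eq_iff_re.1 h3.symm)
  · rw [← h2]
    exact le_trans (by positivity) h1

lemma inv_injective : Function.Injective (boundedInverse D.A) := by
  intro x y hxy
  obtain ⟨h, hx⟩ := D.inv_spec.right_inv x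
  obtain ⟨h', hy⟩ := D.inv_spec.right_inv y
  rw [← hx, ← hy]
  congr 1
  exact Subtype.ext hxy

lemma negPow_half_sq (x : H) :
    negPow D.A (1 / 2) (negPow D.A (1 / 2) x) = boundedInverse D.A x := by
  have h : negPow D.A (1 / 2) * negPow D.A (1 / 2) = boundedInverse D.A := by
    have h1 : negPow D.A (1 / 2) = CFC.sqrt (boundedInverse D.A) := by
      rw [negPow, CFC.sqrt_eq_rpow]
    rw [h1]
    exact CFC.sqrt_mul_sqrt_self _ D.inv_nonneg
  rw [← h]
  rfl

lemma negPow_half_injective : Function.Injective (negPow D.A (1 / 2)) := by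
  intro x y hxy
  apply D.inv_injective
  rw [← negPow_half_sq, ← negPow_half_sq, hxy]

lemma negPow_half_ker :
    ((negPow D.A (1 / 2) : H →ₗ[ℂ] H).toPMap ⊤).toFun.ker = ⊥ := by
  rw [LinearMap.ker_eq_bot]
  intro x y hxy
  exact Subtype.ext (D.negPow_half_injective hxy)

lemma negPow_half_mem (x : H) : negPow D.A (1 / 2) x ∈ D.sqrtA.domain := by
  rw [sqrtA, posPow, LinearPMap.inverse_domain]
  exact ⟨⟨x, trivial⟩, rfl⟩

lemma sqrtA_negPow (x : H) :
    D.sqrtA ⟨negPow D.A (1 / 2) x, D.negPow_half_mem x⟩ = x :=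
  LinearPMap.inverse_apply_eq D.negPow_half_ker
    (x := (⟨x, trivial⟩ : ((negPow D.A (1 / 2) : H →ₗ[ℂ] H).toPMap ⊤).domain)) rfl

lemma negPow_sqrtA (x : D.sqrtA.domain) : negPow D.A (1 / 2) (D.sqrtA x) = x := by
  obtain ⟨x, hx⟩ := x
  have hx' := hx
  rw [sqrtA, posPow, LinearPMap.inverse_domain] at hx'
  obtain ⟨z, rfl⟩ := hx'
  have := D.sqrtA_negPow (z : H)
  exact congrArg (negPow D.A (1 / 2)) this

lemma sqrtA_eq_zero {x : D.sqrtA.domain} (h : D.sqrtA x = 0) : x = 0 := by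
  have := D.negPow_sqrtA x
  rw [h, map_zero] at this
  exact Subtype.ext this.symm

/-- The phase space `ℍ = D(A^{1/2}) × D(A^{1/2}) × H × H`, with elements `(u, v, w, θ)`. -/
def PhaseSpace : Type _ := D.sqrtA.domain × D.sqrtA.domain × H × H

instance : AddCommGroup D.PhaseSpace :=
  inferInstanceAs (AddCommGroup (D.sqrtA.domain × D.sqrtA.domain × H × H))

instance : Module ℂ D.PhaseSpace :=
  inferInstanceAs (Module ℂ (D.sqrtA.domain × D.sqrtA.domain × H × H))

/-- The component `u` of `(u, v, w, θ)`. -/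
def u : D.PhaseSpace →ₗ[ℂ] D.sqrtA.domain where
  toFun U := U.1
  map_add' _ _ := rfl
  map_smul' _ _ := rfl

/-- The component `v` of `(u, v, w, θ)`. -/
def v : D.PhaseSpace →ₗ[ℂ] D.sqrtA.domain where
  toFun U := U.2.1
  map_add' _ _ := rfl
  map_smul' _ _ := rfl

/-- The component `w` of `(u, v, w, θ)`. -/
def w : D.PhaseSpace →ₗ[ℂ] H where
  toFun U := U.2.2.1
  map_add' _ _ := rfl
  map_smul' _ _ := rfl

/-- The component `θ` of `(u, v, w, θ)`. -/
def θ : D.PhaseSpace →ₗ[ℂ] H where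
  toFun U := U.2.2.2
  map_add' _ _ := rfl
  map_smul' _ _ := rfl

/-- The inner product of the phase space (antilinear in the first argument). -/
instance : Inner ℂ D.PhaseSpace where
  inner U₁ U₂ :=
    ((D.a ^ 2 * D.α * (D.β - D.α) : ℝ) : ℂ) *
        inner ℂ (D.sqrtA (D.v U₁)) (D.sqrtA (D.v U₂))
      + ((D.a ^ 2 : ℝ) : ℂ) *
        inner ℂ (D.sqrtA (D.u U₁) + (D.α : ℂ) • D.sqrtA (D.v U₁))
          (D.sqrtA (D.u U₂) + (D.α : ℂ) • D.sqrtA (D.v U₂))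
      + inner ℂ ((D.v U₁ : H) + (D.α : ℂ) • D.w U₁) ((D.v U₂ : H) + (D.α : ℂ) • D.w U₂)
      + inner ℂ (D.θ U₁) (D.θ U₂)

lemma inner_def (U₁ U₂ : D.PhaseSpace) :
    inner ℂ U₁ U₂ =
      ((D.a ^ 2 * D.α * (D.β - D.α) : ℝ) : ℂ) *
        inner ℂ (D.sqrtA (D.v U₁)) (D.sqrtA (D.v U₂))
      + ((D.a ^ 2 : ℝ) : ℂ) *
        inner ℂ (D.sqrtA (D.u U₁) + (D.α : ℂ) • D.sqrtA (D.v U₁))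
          (D.sqrtA (D.u U₂) + (D.α : ℂ) • D.sqrtA (D.v U₂))
      + inner ℂ ((D.v U₁ : H) + (D.α : ℂ) • D.w U₁) ((D.v U₂ : H) + (D.α : ℂ) • D.w U₂)
      + inner ℂ (D.θ U₁) (D.θ U₂) := rfl

lemma coef_pos : 0 < D.a ^ 2 * D.α * (D.β - D.α) := by
  have := D.α_pos
  have := sub_pos.2 D.α_lt_β
  have := D.a_ne_zero
  positivity

lemma sq_pos : 0 < D.a ^ 2 := by
  have := D.a_ne_zero
  positivity

lemma re_inner_self (U : D.PhaseSpace) :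
    (inner ℂ U U).re = D.a ^ 2 * D.α * (D.β - D.α) * ‖D.sqrtA (D.v U)‖ ^ 2
      + D.a ^ 2 * ‖D.sqrtA (D.u U) + (D.α : ℂ) • D.sqrtA (D.v U)‖ ^ 2
      + ‖(D.v U : H) + (D.α : ℂ) • D.w U‖ ^ 2 + ‖D.θ U‖ ^ 2 := by
  rw [inner_def]
  simp only [inner_self_eq_norm_sq_to_K, Complex.add_re, Complex.re_ofReal_mul]
  norm_cast

lemma ext_of {U W : D.PhaseSpace} (hu : D.u U = D.u W) (hv : D.v U = D.v W)
    (hw : D.w U = D.w W) (hθ : D.θ U = D.θ W) : U = W :=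
  Prod.ext hu (Prod.ext hv (Prod.ext hw hθ))

lemma definite (U : D.PhaseSpace) (h : inner ℂ U U = 0) : U = 0 := by
  have h0 := D.re_inner_self U
  rw [h, Complex.zero_re] at h0
  have c1 := D.coef_pos
  have c2 := D.sq_pos
  have p1 : 0 ≤ D.a ^ 2 * D.α * (D.β - D.α) * ‖D.sqrtA (D.v U)‖ ^ 2 := by positivity
  have p2 : 0 ≤ D.a ^ 2 * ‖D.sqrtA (D.u U) + (D.α : ℂ) • D.sqrtA (D.v U)‖ ^ 2 := by positivity
  have p3 := sq_nonneg ‖(D.v U : H) + (D.α : ℂ) • D.w U‖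
  have p4 := sq_nonneg ‖D.θ U‖
  have e1 : D.a ^ 2 * D.α * (D.β - D.α) * ‖D.sqrtA (D.v U)‖ ^ 2 = 0 := by linarith
  have e2 : D.a ^ 2 * ‖D.sqrtA (D.u U) + (D.α : ℂ) • D.sqrtA (D.v U)‖ ^ 2 = 0 := by linarith
  have e3 : ‖(D.v U : H) + (D.α : ℂ) • D.w U‖ ^ 2 = 0 := by linarith
  have e4 : ‖D.θ U‖ ^ 2 = 0 := by linarith
  have q1 : D.sqrtA (D.v U) = 0 := by
    simpa using (mul_eq_zero.1 e1).resolve_left c1.ne'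
  have q2 : D.sqrtA (D.u U) = 0 := by
    have := (mul_eq_zero.1 e2).resolve_left c2.ne'
    simpa [q1] using this
  have hv : D.v U = 0 := D.sqrtA_eq_zero q1
  have hu : D.u U = 0 := D.sqrtA_eq_zero q2
  have hw : D.w U = 0 := by
    have := D.α_pos.ne'
    simpa [hv, this] using e3
  have hθ : D.θ U = 0 := by simpa using e4
  exact D.ext_of (by rw [hu, map_zero]) (by rw [hv, map_zero]) (by rw [hw, map_zero])
    (by rw [hθ, map_zero])

/-- The inner product axioms. -/
abbrev core : InnerProductSpace.Core ℂ D.PhaseSpace where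
  conj_inner_symm U W := by
    simp only [inner_def, map_add, map_mul, Complex.conj_ofReal, inner_conj_symm]
  re_inner_nonneg U := by
    have h := D.re_inner_self U
    have c1 := D.coef_pos
    have c2 := D.sq_pos
    change 0 ≤ (inner ℂ U U).re
    rw [h]
    positivity
  add_left U V W := by
    simp only [inner_def, map_add, LinearPMap.map_add, Submodule.coe_add, smul_add,
      inner_add_left]
    ring
  smul_left U W r := by
    simp only [inner_def, map_smul, LinearPMap.map_smul, Submodule.coe_smul,
      inner_add_left, inner_smul_left]
    ring
  definite := D.definite

instance : NormedAddCommGroup D.PhaseSpace :=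
  @InnerProductSpace.Core.toNormedAddCommGroup ℂ _ _ _ _ D.core

instance : InnerProductSpace ℂ D.PhaseSpace := InnerProductSpace.ofCore D.core.toCore

lemma norm_sq_eq (U : D.PhaseSpace) :
    ‖U‖ ^ 2 = D.a ^ 2 * D.α * (D.β - D.α) * ‖D.sqrtA (D.v U)‖ ^ 2
      + D.a ^ 2 * ‖D.sqrtA (D.u U) + (D.α : ℂ) • D.sqrtA (D.v U)‖ ^ 2
      + ‖(D.v U : H) + (D.α : ℂ) • D.w U‖ ^ 2 + ‖D.θ U‖ ^ 2 := by
  rw [← D.re_inner_self]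
  exact norm_sq_eq_re_inner (𝕜 := ℂ) U

/-- An isometry of the phase space onto `H⁴`. -/
def toPi : D.PhaseSpace →ₗᵢ[ℂ] PiLp 2 (fun _ : Fin 4 => H) where
  toFun U := WithLp.toLp 2
    ![((√(D.a ^ 2 * D.α * (D.β - D.α)) : ℝ) : ℂ) • D.sqrtA (D.v U),
      (D.a : ℂ) • (D.sqrtA (D.u U) + (D.α : ℂ) • D.sqrtA (D.v U)),
      (D.v U : H) + (D.α : ℂ) • D.w U, D.θ U]
  map_add' U W := by
    ext i
    fin_cases i <;> simp [LinearPMap.map_add, smul_add] <;> abel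
  map_smul' c U := by
    ext i
    fin_cases i <;> simp [LinearPMap.map_smul, smul_add, smul_comm c]
  norm_map' U := by
    rw [← sq_eq_sq₀ (norm_nonneg _) (norm_nonneg _), norm_sq_eq]
    have h := D.coef_pos.le
    change ‖(WithLp.toLp 2 _ : PiLp 2 (fun _ : Fin 4 => H))‖ ^ 2 = _
    rw [PiLp.norm_sq_eq_of_L2]
    simp only [Fin.sum_univ_four, Matrix.cons_val, norm_smul, mul_pow, Complex.norm_real,
      Real.norm_eq_abs, sq_abs, Real.sq_sqrt h]

lemma toPi_surjective : Function.Surjective D.toPi := by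
  intro y
  have hs : ((√(D.a ^ 2 * D.α * (D.β - D.α)) : ℝ) : ℂ) ≠ 0 := by
    exact_mod_cast (Real.sqrt_pos.2 D.coef_pos).ne'
  have ha : (D.a : ℂ) ≠ 0 := by exact_mod_cast D.a_ne_zero
  have hα : (D.α : ℂ) ≠ 0 := by exact_mod_cast D.α_pos.ne'
  set p : H := (((√(D.a ^ 2 * D.α * (D.β - D.α)) : ℝ) : ℂ))⁻¹ • y 0 with hp
  set q : H := (D.a : ℂ)⁻¹ • y 1 - (D.α : ℂ) • p with hq
  let U : D.PhaseSpace := (⟨_, D.negPow_half_mem q⟩, ⟨_, D.negPow_half_mem p⟩,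
    (D.α : ℂ)⁻¹ • (y 2 - negPow D.A (1 / 2) p), y 3)
  have hu : D.sqrtA (D.u U) = q := D.sqrtA_negPow q
  have hv : D.sqrtA (D.v U) = p := D.sqrtA_negPow p
  have hv' : (D.v U : H) = negPow D.A (1 / 2) p := rfl
  have hw : D.w U = (D.α : ℂ)⁻¹ • (y 2 - negPow D.A (1 / 2) p) := rfl
  have hθ : D.θ U = y 3 := rfl
  refine ⟨U, ?_⟩
  change WithLp.toLp 2
    ![((√(D.a ^ 2 * D.α * (D.β - D.α)) : ℝ) : ℂ) • D.sqrtA (D.v U),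
      (D.a : ℂ) • (D.sqrtA (D.u U) + (D.α : ℂ) • D.sqrtA (D.v U)),
      (D.v U : H) + (D.α : ℂ) • D.w U, D.θ U] = y
  rw [hu, hv, hv', hw, hθ]
  ext i
  fin_cases i
  · simp [hp, smul_smul, hs]
  · simp [hq, smul_smul, ha]
  · simp [smul_smul, hα]
  · rfl

instance : CompleteSpace D.PhaseSpace :=
  (LinearIsometryEquiv.ofSurjective D.toPi D.toPi_surjective).toIsometryEquiv.completeSpace

/-- The bounded operator `A^{φ-1}` on `H`. -/
def powφ : H →L[ℂ] H := negPow D.A (1 - D.φ)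

/-- `a² u + a² β v - η A^{φ-1} θ`. -/
def first : D.PhaseSpace →ₗ[ℂ] H :=
  ((D.a ^ 2 : ℝ) : ℂ) • (D.sqrtA.domain.subtype ∘ₗ D.u)
    + ((D.a ^ 2 * D.β : ℝ) : ℂ) • (D.sqrtA.domain.subtype ∘ₗ D.v)
    - (D.η : ℂ) • ((D.powφ : H →ₗ[ℂ] H) ∘ₗ D.θ)

/-- `η A^{φ-1} v + α η A^{φ-1} w + θ`. -/
def second : D.PhaseSpace →ₗ[ℂ] H :=
  (D.η : ℂ) • ((D.powφ : H →ₗ[ℂ] H) ∘ₗ D.sqrtA.domain.subtype ∘ₗ D.v)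
    + ((D.α * D.η : ℝ) : ℂ) • ((D.powφ : H →ₗ[ℂ] H) ∘ₗ D.w)
    + D.θ

/-- The domain of `𝔹`: `(u, v, w, θ) ∈ ℍ` with `v, w ∈ D(A^{1/2})`,
`a² u + a² β v - η A^{φ-1} θ ∈ D(A)` and `η A^{φ-1} v + α η A^{φ-1} w + θ ∈ D(A)`. -/
def domB : Submodule ℂ D.PhaseSpace :=
  D.sqrtA.domain.comap D.w ⊓ D.A.domain.comap D.first ⊓ D.A.domain.comap D.second

/-- The operator `𝔹 (u, v, w, θ) = (v, w, -(a² A u + a² β A v - η A^φ θ + w) / α,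
-(η A^φ v + α η A^φ w + A θ))`, where the two combinations are
`A (a² u + a² β v - η A^{φ-1} θ)` and `A (η A^{φ-1} v + α η A^{φ-1} w + θ)`. -/
def 𝔹 : D.PhaseSpace →ₗ.[ℂ] D.PhaseSpace where
  domain := D.domB
  toFun :=
    { toFun := fun U =>
        (D.v U, ⟨D.w U, U.2.1.1⟩,
          -((D.α : ℂ)⁻¹ • (D.A ⟨D.first U, U.2.1.2⟩ + D.w U)),
          -D.A ⟨D.second U, U.2.2⟩)
      map_add' := fun U W => by
        have h1 : D.A ⟨D.first ↑(U + W), (U + W).2.1.2⟩ =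
            D.A ⟨D.first U, U.2.1.2⟩ + D.A ⟨D.first W, W.2.1.2⟩ := by
          rw [← LinearPMap.map_add]
          exact congrArg _ (Subtype.ext (map_add D.first (U : D.PhaseSpace) W))
        have h2 : D.A ⟨D.second ↑(U + W), (U + W).2.2⟩ =
            D.A ⟨D.second U, U.2.2⟩ + D.A ⟨D.second W, W.2.2⟩ := by
          rw [← LinearPMap.map_add]
          exact congrArg _ (Subtype.ext (map_add D.second (U : D.PhaseSpace) W))
        have h3 : D.w ↑(U + W) = D.w U + D.w W := map_add D.w (U : D.PhaseSpace) W
        refine D.ext_of rfl rfl ?_ ?_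
        · change -((D.α : ℂ)⁻¹ • (D.A ⟨D.first ↑(U + W), (U + W).2.1.2⟩ + D.w ↑(U + W))) =
            -((D.α : ℂ)⁻¹ • (D.A ⟨D.first U, U.2.1.2⟩ + D.w U)) +
            -((D.α : ℂ)⁻¹ • (D.A ⟨D.first W, W.2.1.2⟩ + D.w W))
          rw [h1, h3, ← neg_add, ← smul_add]
          congr 2
          abel
        · change -D.A ⟨D.second ↑(U + W), (U + W).2.2⟩ =
            -D.A ⟨D.second U, U.2.2⟩ + -D.A ⟨D.second W, W.2.2⟩
          rw [h2, neg_add]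
      map_smul' := fun c U => by
        have h1 : D.A ⟨D.first ↑(c • U), (c • U).2.1.2⟩ = c • D.A ⟨D.first U, U.2.1.2⟩ := by
          rw [← LinearPMap.map_smul]
          exact congrArg _ (Subtype.ext (map_smul D.first c (U : D.PhaseSpace)))
        have h2 : D.A ⟨D.second ↑(c • U), (c • U).2.2⟩ = c • D.A ⟨D.second U, U.2.2⟩ := by
          rw [← LinearPMap.map_smul]
          exact congrArg _ (Subtype.ext (map_smul D.second c (U : D.PhaseSpace)))
        have h3 : D.w ↑(c • U) = c • D.w U := map_smul D.w c (U : D.PhaseSpace)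
        refine D.ext_of rfl rfl ?_ ?_
        · change -((D.α : ℂ)⁻¹ • (D.A ⟨D.first ↑(c • U), (c • U).2.1.2⟩ + D.w ↑(c • U))) =
            c • -((D.α : ℂ)⁻¹ • (D.A ⟨D.first U, U.2.1.2⟩ + D.w U))
          rw [h1, h3, ← smul_add, smul_comm, smul_neg]
        · change -D.A ⟨D.second ↑(c • U), (c • U).2.2⟩ = c • -D.A ⟨D.second U, U.2.2⟩
          rw [h2, smul_neg] }

end System

end MGTFourier

end

noncomputable section

namespace MGTFourier

/-! ### Energy decay and density arguments for families of contractions. -/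

section Limits

variable {E : Type*} [NormedAddCommGroup E] [InnerProductSpace ℂ E]

/-! Everything rests on two facts about `𝔹`: it is dissipative, and 0 is in its resolvent set
(`IsMaximalDissipative`). On the domain, the last condition forces θ ∈ D(A^{1/2}). The phase-space
inner product is tuned so that the cross terms cancel in the real part, the η-coupling included
because A^{φ-1} is symmetric. What remains is Re⟨𝔹U, U⟩ = -a²(β-α)‖A^{1/2}v‖² - ‖A^{1/2}θ‖²
(`isDissipative_𝔹`). The equation -𝔹U' = F is triangular and is solved explicitly, one component
after another (`exists_𝔹_negInv𝔹`).

The rest is semigroup theory for an arbitrary operator A with these two properties. Dissipativity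
bounds (s - A)⁻¹ by 1/s, which spreads the resolvent set from 0 to all of (0, ∞) and makes the
domain dense. The Yosida approximations are bounded, dissipative and commute with each other; by a
Duhamel estimate their exponentials are Cauchy on D(A), hence everywhere, and the limit is a
contraction semigroup. Its generator extends A and cannot be larger, since 1 - A is already onto
(`isGenerator_semigroup`).

Invertibility of A settles weak solutions without the adjoint semigroup. For existence, writing x =
Ay turns ⟨V, S(t)x⟩ into ⟨A†V, S(t)y⟩, which is differentiable (`isWeakSolution_semigroup`). For
uniqueness, (-A)⁻¹ maps the difference of two weak solutions to a classical solution with zero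
initial value, and the energy estimate kills it (`eqOn_of_isWeakSolution`). Higher regularity holds
because S(t) commutes with A: t ↦ (S(t)x, S(t)Aⁿx) is a curve in the graph of Aⁿ whose derivative is
the same curve for Ax (`contDiffOn_graphOrbit`). -/

lemma norm_le_norm_zero_of_re_inner_deriv_nonpos {f f' : ℝ → E}
    (hf : ∀ t ∈ Set.Ici (0 : ℝ), HasDerivWithinAt f (f' t) (Set.Ici 0) t)
    (h : ∀ t ∈ Set.Ici (0 : ℝ), (inner ℂ (f' t) (f t)).re ≤ 0) {t : ℝ} (ht : 0 ≤ t) :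
    ‖f t‖ ≤ ‖f 0‖ := by
  have hd : ∀ s ∈ Set.Ici (0 : ℝ), HasDerivWithinAt (fun s => (inner ℂ (f s) (f s)).re)
      (2 * (inner ℂ (f' s) (f s)).re) (Set.Ici 0) s := by
    intro s hs
    have h1 := (hf s hs).inner ℂ (hf s hs)
    have h2 := Complex.reCLM.hasFDerivAt.comp_hasDerivWithinAt s h1
    refine h2.congr_deriv ?_
    have h3 : (inner ℂ (f s) (f' s)).re = (inner ℂ (f' s) (f s)).re := by
      rw [← inner_conj_symm, Complex.conj_re]
    simp only [Complex.reCLM_apply, Complex.add_re, h3]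
    ring
  have hanti : AntitoneOn (fun s => (inner ℂ (f s) (f s)).re) (Set.Ici 0) := by
    refine antitoneOn_of_hasDerivWithinAt_nonpos (convex_Ici 0)
      (fun s hs => (hd s hs).continuousWithinAt)
      (fun s hs => (hd s (interior_subset hs)).mono interior_subset) ?_
    intro s hs
    have := h s (interior_subset hs)
    linarith
  have h4 : (inner ℂ (f t) (f t)).re ≤ (inner ℂ (f 0) (f 0)).re :=
    hanti (Set.self_mem_Ici) ht ht
  have e (x : E) : (inner ℂ x x).re = ‖x‖ ^ 2 := (norm_sq_eq_re_inner (𝕜 := ℂ) x).symm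
  rw [e, e] at h4
  exact (sq_le_sq₀ (norm_nonneg _) (norm_nonneg _)).1 h4

lemma tendsto_of_dense_of_norm_le_one {ι : Type*} {l : Filter ι} {F : ι → E →L[ℂ] E}
    {G : E →L[ℂ] E} (hF : ∀ᶠ i in l, ‖F i‖ ≤ 1) (hG : ‖G‖ ≤ 1) {s : Set E} (hs : Dense s)
    (h : ∀ x ∈ s, Filter.Tendsto (fun i => F i x) l (𝓝 (G x))) (x : E) :
    Filter.Tendsto (fun i => F i x) l (𝓝 (G x)) := by
  rw [Metric.tendsto_nhds]
  intro ε hε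
  obtain ⟨y, hy, hxy⟩ := hs.exists_dist_lt x (by positivity : 0 < ε / 3)
  rw [dist_eq_norm] at hxy
  filter_upwards [hF, Metric.tendsto_nhds.1 (h y hy) (ε / 3) (by positivity)] with i hi hi'
  rw [dist_eq_norm] at hi' ⊢
  have h1 : ‖F i (x - y)‖ ≤ ‖x - y‖ := by simpa using (F i).le_of_opNorm_le hi (x - y)
  have h2 : ‖G (x - y)‖ ≤ ‖x - y‖ := by simpa using G.le_of_opNorm_le hG (x - y)
  have h3 : F i x - G x = F i (x - y) + (F i y - G y) - G (x - y) := by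
    simp only [map_sub]; abel
  rw [h3]
  have := norm_sub_le (F i (x - y) + (F i y - G y)) (G (x - y))
  have := norm_add_le (F i (x - y)) (F i y - G y)
  linarith

lemma cauchySeq_of_dense_of_norm_le_one {F : ℕ → E →L[ℂ] E}
    (hF : ∀ n, ‖F n‖ ≤ 1) {s : Set E} (hs : Dense s)
    (h : ∀ x ∈ s, CauchySeq fun n => F n x) (x : E) : CauchySeq fun n => F n x := by
  rw [Metric.cauchySeq_iff']
  intro ε hε
  obtain ⟨y, hy, hxy⟩ := hs.exists_dist_lt x (by positivity : 0 < ε / 3)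
  rw [dist_eq_norm] at hxy
  obtain ⟨N, hN⟩ := Metric.cauchySeq_iff'.1 (h y hy) (ε / 3) (by positivity)
  refine ⟨N, fun n hn => ?_⟩
  have h0 := hN n hn
  rw [dist_eq_norm] at h0 ⊢
  have h1 (i) : ‖F i (x - y)‖ ≤ ‖x - y‖ := by simpa using (F i).le_of_opNorm_le (hF i) (x - y)
  have h3 : F n x - F N x = F n (x - y) + (F n y - F N y) - F N (x - y) := by
    simp only [map_sub]; abel
  rw [h3]
  have := norm_sub_le (F n (x - y) + (F n y - F N y)) (F N (x - y))
  have := norm_add_le (F n (x - y)) (F n y - F N y)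
  have := h1 n
  have := h1 N
  linarith

end Limits

/-! ### Resolvents of dissipative operators. -/

section Resolvent

variable {E : Type*} [NormedAddCommGroup E] [InnerProductSpace ℂ E]

/-- `R` is the resolvent `(z - A)⁻¹`. -/
structure IsResolvent (A : E →ₗ.[ℂ] E) (z : ℂ) (R : E →L[ℂ] E) : Prop where
  left_inv : ∀ x : A.domain, R (z • (x : E) - A x) = x
  right_inv : ∀ y : E, ∃ h : R y ∈ A.domain, z • R y - A ⟨R y, h⟩ = y

lemma mem_resolventSet_iff {A : E →ₗ.[ℂ] E} {z : ℂ} :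
    z ∈ resolventSet A ↔ ∃ R, IsResolvent A z R :=
  ⟨fun ⟨R, h, h'⟩ => ⟨R, h, h'⟩, fun ⟨R, h⟩ => ⟨R, h.1, h.2⟩⟩

namespace IsResolvent

variable {A : E →ₗ.[ℂ] E} {z : ℂ} {R : E →L[ℂ] E}

lemma mem (h : IsResolvent A z R) (y : E) : R y ∈ A.domain := (h.right_inv y).1

lemma apply_eq (h : IsResolvent A z R) (y : E) : A ⟨R y, h.mem y⟩ = z • R y - y := by
  obtain ⟨_, h'⟩ := h.right_inv y
  rw [eq_sub_iff_add_eq, ← eq_sub_iff_add_eq', h']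

lemma apply_apply (h : IsResolvent A z R) (x : A.domain) : R (A x) = z • R x - x := by
  have := h.left_inv x
  rw [map_sub, map_smul] at this
  rw [eq_sub_iff_add_eq, ← eq_sub_iff_add_eq', this]

/-- The resolvent identity. -/
lemma sub_smul_apply_apply (h : IsResolvent A z R) {w : ℂ} {R' : E →L[ℂ] E}
    (h' : IsResolvent A w R') (x : E) : (z - w) • R (R' x) = R' x - R x := by
  have e := h.apply_apply ⟨_, h'.mem x⟩
  rw [h'.apply_eq, map_sub, map_smul] at e
  change w • R (R' x) - R x = z • R (R' x) - R' x at e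
  rw [sub_smul, sub_eq_sub_iff_add_eq_add, add_comm (R' x), ← sub_eq_sub_iff_add_eq_add, e]

/-- The resolvent set is open, with a quantitative radius. -/
lemma exists_of_norm_lt [CompleteSpace E] (h : IsResolvent A z R) {w : ℂ}
    (hw : ‖w - z‖ * ‖R‖ < 1) : ∃ R', IsResolvent A w R' := by
  have hlt : ‖-((w - z) • R)‖ < 1 := by rwa [norm_neg, norm_smul]
  set G := Units.oneSub (-((w - z) • R)) hlt with hG
  -- On the domain, w - A = (1 + (w - z)R)(z - A), so the new resolvent is R G⁻¹, with G inverted by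
  -- a Neumann series. That R commutes with G⁻¹ gives the left-inverse property.
  have hGv : (G : E →L[ℂ] E) = 1 + (w - z) • R := by
    rw [hG, Units.val_oneSub, sub_neg_eq_add]
  have hcomm : Commute R (G : E →L[ℂ] E) := by
    rw [hGv]
    exact (Commute.one_right R).add_right ((Commute.refl R).smul_right _)
  have hcomm' : Commute R (↑G⁻¹ : E →L[ℂ] E) := hcomm.units_inv_right
  have h1 (y : E) : (↑G⁻¹ : E →L[ℂ] E) y + (w - z) • R ((↑G⁻¹ : E →L[ℂ] E) y) = y := by
    have : (G : E →L[ℂ] E) ((↑G⁻¹ : E →L[ℂ] E) y) = y := by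
      rw [← mul_apply_eq_comp, Units.mul_inv, one_apply_eq_self]
    rw [hGv] at this
    exact this
  have h2 (y : E) : (↑G⁻¹ : E →L[ℂ] E) (y + (w - z) • R y) = y := by
    have : (↑G⁻¹ : E →L[ℂ] E) ((G : E →L[ℂ] E) y) = y := by
      rw [← mul_apply_eq_comp, Units.inv_mul, one_apply_eq_self]
    rw [hGv] at this
    exact this
  refine ⟨R * ↑G⁻¹, fun x => ?_, fun y => ⟨h.mem _, ?_⟩⟩
  · rw [hcomm'.eq, mul_apply_eq_comp, map_sub, map_smul, h.apply_apply]
    convert h2 x using 2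
    module
  · refine Eq.trans (congrArg (fun t => w • R ((↑G⁻¹ : E →L[ℂ] E) y) - t)
      (h.apply_eq ((↑G⁻¹ : E →L[ℂ] E) y))) ?_
    nth_rewrite 4 [← h1 y]
    module

/-- Dissipativity at R y, where A(Ry) = zRy - y, gives Re z ‖Ry‖² ≤ Re⟨y, Ry⟩; conclude by
Cauchy–Schwarz. -/
lemma norm_le (h : IsResolvent A z R) (hd : IsDissipative A) (y : E) :
    z.re * ‖R y‖ ≤ ‖y‖ := by
  have h1 := hd ⟨R y, h.mem y⟩
  rw [h.apply_eq, inner_sub_left, inner_smul_left, inner_self_eq_norm_sq_to_K] at h1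
  have h2 : (inner ℂ y (R y)).re ≤ ‖y‖ * ‖R y‖ := re_inner_le_norm (𝕜 := ℂ) y (R y)
  have h3 : ((starRingEnd ℂ) z * (RCLike.ofReal ‖R y‖ : ℂ) ^ 2).re = z.re * ‖R y‖ ^ 2 := by
    have : (RCLike.ofReal ‖R y‖ : ℂ) ^ 2 = ((‖R y‖ ^ 2 : ℝ) : ℂ) := by norm_cast
    rw [this, Complex.re_mul_ofReal, Complex.conj_re]
  rw [Complex.sub_re] at h1
  erw [h3] at h1
  rcases eq_or_lt_of_le (norm_nonneg (R y)) with h0 | h0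
  · rw [← h0]; simp
  · nlinarith

end IsResolvent

variable [CompleteSpace E] {A : E →ₗ.[ℂ] E}

/-- Since the resolvent at r has norm at most 1/r, the Neumann series converges on the whole disc of
radius r about r. -/
lemma ofReal_mem_resolventSet_of_lt_two_mul (hd : IsDissipative A) {r s : ℝ} (hr : 0 < r)
    (h : (r : ℂ) ∈ resolventSet A) (hs : 0 < s) (hsr : s < 2 * r) :
    (s : ℂ) ∈ resolventSet A := by
  rw [mem_resolventSet_iff] at h ⊢
  obtain ⟨R, hR⟩ := h
  have h1 : ‖R‖ ≤ r⁻¹ := by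
    refine R.opNorm_le_bound (by positivity) fun y => ?_
    have := hR.norm_le hd y
    rw [Complex.ofReal_re] at this
    rw [inv_mul_eq_div, le_div_iff₀ hr]
    linarith
  apply hR.exists_of_norm_lt
  rw [← Complex.ofReal_sub, Complex.norm_real, Real.norm_eq_abs]
  have h2 : |s - r| < r := abs_lt.2 ⟨by linarith, by linarith⟩
  calc |s - r| * ‖R‖ ≤ |s - r| * r⁻¹ := by gcongr
    _ < r * r⁻¹ := by gcongr
    _ = 1 := mul_inv_cancel₀ hr.ne'

/-- The resolvent set of a dissipative operator contains `(0, ∞)` as soon as it contains `0`. -/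
lemma ofReal_mem_resolventSet (hd : IsDissipative A) (h : 0 ∈ resolventSet A) {s : ℝ}
    (hs : 0 < s) : (s : ℂ) ∈ resolventSet A := by
  obtain ⟨R, hR⟩ := mem_resolventSet_iff.1 h
  obtain ⟨δ, hδ, hδ'⟩ : ∃ δ : ℝ, 0 < δ ∧ δ * ‖R‖ < 1 := by
    refine ⟨(‖R‖ + 1)⁻¹, by positivity, ?_⟩
    rw [inv_mul_eq_div, div_lt_one (by positivity)]
    linarith
  -- Openness at 0 gives (0, δ); each further step enlarges the interval by 3/2, any factor strictly
  -- between 1 and 2 being admissible.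
  have key : ∀ n : ℕ, ∀ s : ℝ, 0 < s → s < (3 / 2) ^ n * δ → (s : ℂ) ∈ resolventSet A := by
    intro n
    induction n with
    | zero =>
      intro s hs hsδ
      rw [pow_zero, one_mul] at hsδ
      refine mem_resolventSet_iff.2 (hR.exists_of_norm_lt ?_)
      rw [sub_zero, Complex.norm_real, Real.norm_eq_abs, abs_of_pos hs]
      exact lt_of_le_of_lt (by gcongr) hδ'
    | succ n ih =>
      intro s hs hsδ
      rw [pow_succ] at hsδ
      exact ofReal_mem_resolventSet_of_lt_two_mul hd (r := 2 / 3 * s) (by positivity)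
        (ih _ (by positivity) (by linarith)) hs (by linarith)
  obtain ⟨n, hn⟩ := pow_unbounded_of_one_lt (s / δ) (by norm_num : (1 : ℝ) < 3 / 2)
  exact key n s hs ((div_lt_iff₀ hδ).1 hn)

/-- A maximal dissipative operator on a Hilbert space is densely defined. -/
lemma dense_domain (hd : IsDissipative A) (h : 0 ∈ resolventSet A) :
    Dense (A.domain : Set E) := by
  rw [Submodule.dense_iff_topologicalClosure_eq_top, Submodule.topologicalClosure_eq_top_iff,
    Submodule.eq_bot_iff]
  intro x hx
  obtain ⟨R, hR⟩ := mem_resolventSet_iff.1 (ofReal_mem_resolventSet hd h one_pos)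
  -- With R = (1 - A)⁻¹ and x orthogonal to the domain, dissipativity at Rx reduces to ‖Rx‖² ≤ 0, so
  -- Rx = 0 and hence x = 0.
  have h1 : inner ℂ (R x) x = 0 := hx _ (hR.mem x)
  have h2 := hd ⟨R x, hR.mem x⟩
  rw [hR.apply_eq, inner_sub_left, ← inner_conj_symm x, h1, map_zero, sub_zero,
    inner_smul_left, Complex.conj_ofReal, Complex.re_ofReal_mul, one_mul, inner_self_eq_norm_sq_to_K] at h2
  have h3 : ‖R x‖ ^ 2 ≤ 0 := by exact_mod_cast h2
  have h4 : R x = 0 := by simpa using le_antisymm h3 (sq_nonneg _)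
  obtain ⟨h5, h6⟩ := hR.right_inv x
  have h7 : A ⟨R x, h5⟩ = 0 := by
    have : (⟨R x, h5⟩ : A.domain) = 0 := Subtype.ext h4
    rw [this, LinearPMap.map_zero]
  rw [← h6, h7, h4, smul_zero, sub_zero]

end Resolvent

end MGTFourier
end

noncomputable section

namespace MGTFourier

/-! ### Exponentials of bounded dissipative operators. -/

section BoundedGenerator

open NormedSpace (exp)

variable {E : Type*} [NormedAddCommGroup E] [InnerProductSpace ℂ E] [CompleteSpace E]

lemma hasDerivAt_exp_smul_apply (Y : E →L[ℂ] E) (x : E) (t : ℝ) :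
    HasDerivAt (fun s : ℝ => exp (s • Y) x) (exp (t • Y) (Y x)) t :=
  ((ContinuousLinearMap.apply ℂ E x).restrictScalars ℝ).hasFDerivAt.comp_hasDerivAt t
    (hasDerivAt_exp_smul_const Y t)

lemma hasDerivAt_exp_smul_apply' (Y : E →L[ℂ] E) (x : E) (t : ℝ) :
    HasDerivAt (fun s : ℝ => exp (s • Y) x) (Y (exp (t • Y) x)) t :=
  ((ContinuousLinearMap.apply ℂ E x).restrictScalars ℝ).hasFDerivAt.comp_hasDerivAt t
    (hasDerivAt_exp_smul_const' Y t)

lemma exp_add_smul (Y : E →L[ℂ] E) (s t : ℝ) :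
    exp ((s + t) • Y) = exp (s • Y) * exp (t • Y) := by
  let +nondep : NormedAlgebra ℚ (E →L[ℂ] E) := .restrictScalars ℚ ℂ _
  rw [add_smul, NormedSpace.exp_add_of_commute]
  exact ((Commute.refl Y).smul_left s).smul_right t

lemma norm_exp_smul_le_one {Y : E →L[ℂ] E} (hY : ∀ x, (inner ℂ (Y x) x).re ≤ 0) {t : ℝ}
    (ht : 0 ≤ t) : ‖exp (t • Y)‖ ≤ 1 := by
  refine ContinuousLinearMap.opNorm_le_bound _ zero_le_one fun x => ?_
  have h := norm_le_norm_zero_of_re_inner_deriv_nonpos (f := fun s : ℝ => exp (s • Y) x)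
    (f' := fun s => Y (exp (s • Y) x))
    (fun s _ => (hasDerivAt_exp_smul_apply' Y x s).hasDerivWithinAt) (fun s _ => hY _) ht
  simpa using h

/-- Duhamel's argument: s ↦ e^{sY} e^{(t-s)Z} x joins the two orbits, and by commutation its
derivative is a contraction applied to (Y - Z)x. -/
lemma norm_exp_smul_sub_exp_smul_le {Y Z : E →L[ℂ] E} (hYZ : Commute Y Z)
    (hY : ∀ x, (inner ℂ (Y x) x).re ≤ 0) (hZ : ∀ x, (inner ℂ (Z x) x).re ≤ 0) {t : ℝ}
    (ht : 0 ≤ t) (x : E) : ‖exp (t • Y) x - exp (t • Z) x‖ ≤ ‖Y x - Z x‖ * t := by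
  let +nondep : NormedAlgebra ℚ (E →L[ℂ] E) := .restrictScalars ℚ ℂ _
  have hc (s : ℝ) : exp (t • Z) * exp (s • (Y - Z)) = exp (s • Y) * exp ((t - s) • Z) := by
    have h1 : Commute (t • Z) (s • (Y - Z)) :=
      ((hYZ.symm.sub_right (Commute.refl Z)).smul_left t).smul_right s
    have h2 : Commute (s • Y) ((t - s) • Z) := (hYZ.smul_left s).smul_right (t - s)
    rw [← NormedSpace.exp_add_of_commute h1, ← NormedSpace.exp_add_of_commute h2]
    congr 1
    module
  have hd (s : ℝ) : HasDerivAt (fun s : ℝ => exp (t • Z) (exp (s • (Y - Z)) x))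
      (exp (t • Z) (exp (s • (Y - Z)) ((Y - Z) x))) s :=
    ((exp (t • Z)).restrictScalars ℝ).hasFDerivAt.comp_hasDerivAt s
      (hasDerivAt_exp_smul_apply (Y - Z) x s)
  have h := norm_image_sub_le_of_norm_deriv_le_segment' (C := ‖Y x - Z x‖) (a := 0) (b := t)
    (fun s _ => (hd s).hasDerivWithinAt) (fun s hs => by
      change ‖(exp (t • Z) * exp (s • (Y - Z))) ((Y - Z) x)‖ ≤ _
      have h1 := norm_exp_smul_le_one hY hs.1
      have h2 := norm_exp_smul_le_one hZ (sub_nonneg.2 hs.2.le)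
      rw [hc]
      refine (ContinuousLinearMap.le_of_opNorm_le _ ((norm_mul_le _ _).trans
        (mul_le_one₀ h1 (norm_nonneg _) h2)) _).trans ?_
      rw [one_mul, sub_apply]) t ⟨ht, le_rfl⟩
  have e1 : exp (t • Z) (exp (t • (Y - Z)) x) = exp (t • Y) x := by
    rw [← mul_apply_eq_comp, hc, sub_self, zero_smul, NormedSpace.exp_zero, mul_one]
  have e2 : exp (t • Z) (exp ((0 : ℝ) • (Y - Z)) x) = exp (t • Z) x := by
    rw [zero_smul, NormedSpace.exp_zero, one_apply_eq_self]
  simp only [e1, e2, sub_zero] at h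
  exact h

lemma norm_exp_smul_apply_sub_le {Y : E →L[ℂ] E} (hY : ∀ x, (inner ℂ (Y x) x).re ≤ 0)
    {t : ℝ} (ht : 0 ≤ t) (x : E) : ‖exp (t • Y) x - x‖ ≤ ‖Y x‖ * t := by
  simpa using norm_exp_smul_sub_exp_smul_le (Commute.zero_right Y) hY (by simp) ht x

/-- A first-order Taylor bound that will be uniform along the Yosida approximations. There y = Ax
need not lie in the domain, so a nearby z in the domain is inserted, for which ‖Yz‖ stays bounded.
-/
lemma norm_exp_smul_apply_sub_sub_le {Y : E →L[ℂ] E} (hY : ∀ x, (inner ℂ (Y x) x).re ≤ 0)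
    {t : ℝ} (ht : 0 ≤ t) (x y z : E) :
    ‖exp (t • Y) x - x - t • y‖ ≤ (‖Y x - y‖ + ‖Y z‖ * t + 2 * ‖y - z‖) * t := by
  have hd (s : ℝ) : HasDerivAt (fun s : ℝ => exp (s • Y) x - s • y)
      (exp (s • Y) (Y x) - y) s :=
    (hasDerivAt_exp_smul_apply Y x s).sub (by simpa using (hasDerivAt_id s).smul_const y)
  have h := norm_image_sub_le_of_norm_deriv_le_segment' (a := 0) (b := t)
    (C := ‖Y x - y‖ + ‖Y z‖ * t + 2 * ‖y - z‖)
    (fun s _ => (hd s).hasDerivWithinAt) (fun s hs => by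
      have hb (v : E) : ‖exp (s • Y) v‖ ≤ ‖v‖ := by
        simpa using ContinuousLinearMap.le_of_opNorm_le _ (norm_exp_smul_le_one hY hs.1) v
      have e : exp (s • Y) (Y x) - y = exp (s • Y) (Y x - y) + (exp (s • Y) z - z)
          + exp (s • Y) (y - z) - (y - z) := by
        simp only [map_sub]; abel
      have h1 := norm_exp_smul_apply_sub_le hY hs.1 z
      have h2 : ‖Y z‖ * s ≤ ‖Y z‖ * t := by
        have := hs.2.le
        gcongr
      have h3 := hb (Y x - y)
      have h4 := hb (y - z)
      rw [e]
      have := norm_sub_le (exp (s • Y) (Y x - y) + (exp (s • Y) z - z)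
          + exp (s • Y) (y - z)) (y - z)
      have := norm_add_le (exp (s • Y) (Y x - y) + (exp (s • Y) z - z))
          (exp (s • Y) (y - z))
      have := norm_add_le (exp (s • Y) (Y x - y)) (exp (s • Y) z - z)
      linarith) t ⟨ht, le_rfl⟩
  have e1 : exp (t • Y) x - t • y - (exp ((0 : ℝ) • Y) x - (0 : ℝ) • y)
      = exp (t • Y) x - x - t • y := by
    rw [zero_smul, zero_smul, NormedSpace.exp_zero, one_apply_eq_self]; abel
  simp only [e1, sub_zero] at h
  exact h

end BoundedGenerator

/-! ### Yosida approximation of a maximal dissipative operator. -/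

section Yosida

open NormedSpace (exp)

variable {E : Type*} [NormedAddCommGroup E] [InnerProductSpace ℂ E]
variable {A : E →ₗ.[ℂ] E}

/-- The resolvent at `n + 1`, and `0` if there is none. -/
def natResolvent (A : E →ₗ.[ℂ] E) (n : ℕ) : E →L[ℂ] E :=
  open scoped Classical in
  if h : ∃ R, IsResolvent A ((n + 1 : ℝ) : ℂ) R then h.choose else 0

/-- The Yosida approximation `λ² (λ - A)⁻¹ - λ` with `λ = n + 1`. -/
def yosida (A : E →ₗ.[ℂ] E) (n : ℕ) : E →L[ℂ] E :=
  ((n + 1 : ℝ) : ℂ) • (((n + 1 : ℝ) : ℂ) • natResolvent A n - 1)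

lemma yosida_apply (n : ℕ) (x : E) :
    yosida A n x = ((n + 1 : ℝ) : ℂ) • (((n + 1 : ℝ) : ℂ) • natResolvent A n x - x) := rfl

/-- `A` is a dissipative operator whose resolvent set contains `0`. -/
structure IsMaximalDissipative (A : E →ₗ.[ℂ] E) : Prop where
  isDissipative : IsDissipative A
  zero_mem : 0 ∈ resolventSet A

lemma IsMaximalDissipative.exists_mem_graph (h : IsMaximalDissipative A) (y : E) : ∃ x, (x, y) ∈ A.graph := by
  obtain ⟨R, hR⟩ := mem_resolventSet_iff.1 h.zero_mem
  refine ⟨R (-y), (LinearPMap.mem_graph_iff _).2 ⟨⟨_, hR.mem (-y)⟩, rfl, ?_⟩⟩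
  rw [hR.apply_eq, zero_smul, zero_sub, neg_neg]

variable [CompleteSpace E]

namespace IsMaximalDissipative

lemma natResolvent_spec (h : IsMaximalDissipative A) (n : ℕ) :
    IsResolvent A ((n + 1 : ℝ) : ℂ) (natResolvent A n) := by
  have h' : ∃ R, IsResolvent A ((n + 1 : ℝ) : ℂ) R :=
    mem_resolventSet_iff.1 (ofReal_mem_resolventSet h.1 h.2 (by positivity))
  rw [natResolvent, dif_pos h']
  exact h'.choose_spec

lemma dense_domain (h : IsMaximalDissipative A) : Dense (A.domain : Set E) :=
  MGTFourier.dense_domain h.1 h.2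

lemma mul_norm_natResolvent_le (h : IsMaximalDissipative A) (n : ℕ) (x : E) :
    (n + 1 : ℝ) * ‖natResolvent A n x‖ ≤ ‖x‖ := by
  simpa only [Complex.ofReal_re] using (h.natResolvent_spec n).norm_le h.1 x

lemma norm_smul_natResolvent_le (h : IsMaximalDissipative A) (n : ℕ) :
    ‖((n + 1 : ℝ) : ℂ) • natResolvent A n‖ ≤ 1 := by
  refine ContinuousLinearMap.opNorm_le_bound _ zero_le_one fun x => ?_
  rw [smul_apply, norm_smul, Complex.norm_real, one_mul, Real.norm_eq_abs,
    abs_of_pos (by positivity)]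
  exact h.mul_norm_natResolvent_le n x

lemma yosida_apply_domain (h : IsMaximalDissipative A) (n : ℕ) (x : A.domain) :
    yosida A n x = ((n + 1 : ℝ) : ℂ) • natResolvent A n (A x) := by
  rw [yosida_apply, (h.natResolvent_spec n).apply_apply]

lemma norm_yosida_le (h : IsMaximalDissipative A) (n : ℕ) (x : A.domain) :
    ‖yosida A n x‖ ≤ ‖A x‖ := by
  rw [h.yosida_apply_domain]
  simpa using ContinuousLinearMap.le_of_opNorm_le _ (h.norm_smul_natResolvent_le n) (A x)

/-- On the domain, λR_λ x - x = R_λ Ax has norm at most ‖Ax‖/λ; density and the uniform bound by 1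
do the rest. -/
lemma tendsto_smul_natResolvent (h : IsMaximalDissipative A) (x : E) :
    Filter.Tendsto (fun n : ℕ => ((n + 1 : ℝ) : ℂ) • natResolvent A n x) Filter.atTop
      (𝓝 x) := by
  refine tendsto_of_dense_of_norm_le_one (G := 1)
    (F := fun n : ℕ => ((n + 1 : ℝ) : ℂ) • natResolvent A n)
    (Filter.Eventually.of_forall h.norm_smul_natResolvent_le)
    ContinuousLinearMap.norm_id_le h.dense_domain (fun x hx => ?_) x
  rw [tendsto_iff_norm_sub_tendsto_zero]
  have h0 : Filter.Tendsto (fun n : ℕ => (1 / ((n : ℝ) + 1)) * ‖A ⟨x, hx⟩‖) Filter.atTop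
      (𝓝 0) := by
    simpa using tendsto_one_div_add_atTop_nhds_zero_nat.mul_const ‖A ⟨x, hx⟩‖
  refine squeeze_zero (fun _ => norm_nonneg _) (fun n => ?_) h0
  have e := (h.natResolvent_spec n).apply_apply ⟨x, hx⟩
  change ‖((n + 1 : ℝ) : ℂ) • natResolvent A n x - x‖ ≤ _
  rw [← e, one_div, inv_mul_eq_div, le_div_iff₀ (by positivity), mul_comm]
  exact h.mul_norm_natResolvent_le n _

lemma tendsto_yosida (h : IsMaximalDissipative A) (x : A.domain) :
    Filter.Tendsto (fun n => yosida A n x) Filter.atTop (𝓝 (A x)) := by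
  simp only [h.yosida_apply_domain]
  exact h.tendsto_smul_natResolvent (A x)

/-- A contraction minus the identity is dissipative, and the Yosida approximation is a positive
multiple of one. -/
lemma re_inner_yosida_nonpos (h : IsMaximalDissipative A) (n : ℕ) (x : E) :
    (inner ℂ (yosida A n x) x).re ≤ 0 := by
  rw [yosida_apply, inner_smul_left, Complex.conj_ofReal, Complex.re_ofReal_mul, inner_sub_left,
    Complex.sub_re]
  have h1 : (inner ℂ (((n + 1 : ℝ) : ℂ) • natResolvent A n x) x).re ≤ ‖x‖ * ‖x‖ :=
    (re_inner_le_norm (𝕜 := ℂ) _ _).trans (mul_le_mul_of_nonneg_right (by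
      simpa using ContinuousLinearMap.le_of_opNorm_le _ (h.norm_smul_natResolvent_le n) x)
      (norm_nonneg _))
  have h2 : (inner ℂ x x).re = ‖x‖ * ‖x‖ := by
    rw [← sq]; exact (norm_sq_eq_re_inner (𝕜 := ℂ) x).symm
  rw [h2]
  exact mul_nonpos_of_nonneg_of_nonpos (by positivity) (by linarith)

lemma commute_natResolvent (h : IsMaximalDissipative A) (m n : ℕ) :
    Commute (natResolvent A m) (natResolvent A n) := by
  by_cases hmn : m = n
  · rw [hmn]
  have hm := h.natResolvent_spec m
  have hn := h.natResolvent_spec n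
  have hne : ((m + 1 : ℝ) : ℂ) - ((n + 1 : ℝ) : ℂ) ≠ 0 := by
    rw [← Complex.ofReal_sub, Complex.ofReal_ne_zero]
    intro h0
    apply hmn
    have : (m : ℝ) = n := by linarith
    exact_mod_cast this
  rw [commute_iff_eq]
  ext x
  simp only [mul_apply_eq_comp]
  apply smul_right_injective _ hne
  change _ = (((m + 1 : ℝ) : ℂ) - ((n + 1 : ℝ) : ℂ)) •
    natResolvent A n (natResolvent A m x)
  rw [← neg_sub ((n + 1 : ℝ) : ℂ), neg_smul, hn.sub_smul_apply_apply hm, neg_sub]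
  exact (hm.sub_smul_apply_apply hn x).trans (neg_sub _ _).symm

lemma commute_yosida (h : IsMaximalDissipative A) (m n : ℕ) :
    Commute (yosida A m) (yosida A n) := by
  have h1 := h.commute_natResolvent m n
  have h2 := ((h1.smul_left ((m + 1 : ℝ) : ℂ)).smul_right ((n + 1 : ℝ) : ℂ))
  exact ((((h2.sub_left (Commute.one_left _)).sub_right
    ((Commute.one_right _))).smul_left ((m + 1 : ℝ) : ℂ)).smul_right ((n + 1 : ℝ) : ℂ))

lemma cauchySeq_exp_yosida (h : IsMaximalDissipative A) (t : ℝ≥0) (x : E) :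
    CauchySeq fun n => exp ((t : ℝ) • yosida A n) x := by
  refine cauchySeq_of_dense_of_norm_le_one
    (fun n => norm_exp_smul_le_one (h.re_inner_yosida_nonpos n) t.2) h.dense_domain
    (fun x hx => ?_) x
  have h0 := (h.tendsto_yosida ⟨x, hx⟩).cauchySeq
  rw [Metric.cauchySeq_iff'] at h0 ⊢
  intro ε hε
  -- The Duhamel bound carries a factor t; dividing by t + 1 instead also covers t = 0.
  obtain ⟨N, hN⟩ := h0 (ε / (t + 1)) (by positivity)
  refine ⟨N, fun n hn => ?_⟩
  have h1 := hN n hn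
  rw [dist_eq_norm] at h1 ⊢
  refine (norm_exp_smul_sub_exp_smul_le (h.commute_yosida n N) (h.re_inner_yosida_nonpos n)
    (h.re_inner_yosida_nonpos N) t.2 x).trans_lt ?_
  rw [lt_div_iff₀ (by positivity)] at h1
  refine lt_of_le_of_lt ?_ h1
  gcongr
  exact le_add_of_nonneg_right zero_le_one

end IsMaximalDissipative

end Yosida

end MGTFourier
end

noncomputable section

namespace MGTFourier

/-! ### The limit semigroup and its generator. -/

section Semigroup

open NormedSpace (exp)

variable {E : Type*} [NormedAddCommGroup E] [InnerProductSpace ℂ E] [CompleteSpace E]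
variable {A : E →ₗ.[ℂ] E}

namespace IsMaximalDissipative

lemma norm_exp_yosida_le_one (h : IsMaximalDissipative A) (t : ℝ≥0) (n : ℕ) :
    ‖exp ((t : ℝ) • yosida A n)‖ ≤ 1 :=
  norm_exp_smul_le_one (h.re_inner_yosida_nonpos n) t.2

lemma exists_tendsto_exp_yosida (h : IsMaximalDissipative A) :
    ∃ S : ℝ≥0 → E →L[ℂ] E, ∀ (t : ℝ≥0) (x : E),
      Filter.Tendsto (fun n => exp ((t : ℝ) • yosida A n) x) Filter.atTop (𝓝 (S t x)) := by
  choose f hf using fun (t : ℝ≥0) (x : E) =>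
    cauchySeq_tendsto_of_complete (h.cauchySeq_exp_yosida t x)
  refine ⟨fun t => (linearMapOfTendsto (f t)
    (fun n => (exp ((t : ℝ) • yosida A n) : E →L[ℂ] E).toLinearMap) (l := Filter.atTop)
    (tendsto_pi_nhds.2 (hf t))).mkContinuous 1 fun x => ?_, hf⟩
  refine le_of_tendsto (hf t x).norm (Filter.Eventually.of_forall fun n => ?_)
  exact ContinuousLinearMap.le_of_opNorm_le _ (h.norm_exp_yosida_le_one t n) x

/-- The contraction semigroup generated by a maximal dissipative operator, as the limit of the
semigroups of its Yosida approximations. -/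
def semigroup (h : IsMaximalDissipative A) : ℝ≥0 → E →L[ℂ] E :=
  h.exists_tendsto_exp_yosida.choose

lemma tendsto_semigroup (h : IsMaximalDissipative A) (t : ℝ≥0) (x : E) :
    Filter.Tendsto (fun n => exp ((t : ℝ) • yosida A n) x) Filter.atTop
      (𝓝 (h.semigroup t x)) :=
  h.exists_tendsto_exp_yosida.choose_spec t x

lemma norm_semigroup_apply_le (h : IsMaximalDissipative A) (t : ℝ≥0) (x : E) :
    ‖h.semigroup t x‖ ≤ ‖x‖ := by
  refine le_of_tendsto (h.tendsto_semigroup t x).norm (Filter.Eventually.of_forall fun n => ?_)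
  simpa using ContinuousLinearMap.le_of_opNorm_le _ (h.norm_exp_yosida_le_one t n) x

lemma norm_semigroup_le_one (h : IsMaximalDissipative A) (t : ℝ≥0) : ‖h.semigroup t‖ ≤ 1 :=
  ContinuousLinearMap.opNorm_le_bound _ zero_le_one fun x => by
    simpa using h.norm_semigroup_apply_le t x

lemma semigroup_zero (h : IsMaximalDissipative A) :
    h.semigroup 0 = ContinuousLinearMap.id ℂ E := by
  ext x
  refine tendsto_nhds_unique (h.tendsto_semigroup 0 x) ?_
  simp [NormedSpace.exp_zero]

lemma semigroup_add (h : IsMaximalDissipative A) (s t : ℝ≥0) :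
    h.semigroup (s + t) = (h.semigroup s).comp (h.semigroup t) := by
  ext x
  refine tendsto_nhds_unique (h.tendsto_semigroup (s + t) x) ?_
  -- Uniform contractivity lets the inner orbit be replaced by its limit before passing to the limit
  -- in the outer factor.
  have h1 : Filter.Tendsto (fun n => exp ((s : ℝ) • yosida A n)
      (exp ((t : ℝ) • yosida A n) x - h.semigroup t x)) Filter.atTop (𝓝 0) := by
    have h0 := tendsto_iff_norm_sub_tendsto_zero.1 (h.tendsto_semigroup t x)
    refine squeeze_zero_norm (fun n => ?_) h0
    exact (ContinuousLinearMap.le_of_opNorm_le _ (h.norm_exp_yosida_le_one s n) _).trans_eq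
      (one_mul _)
  have h2 := h1.add (h.tendsto_semigroup s (h.semigroup t x))
  rw [zero_add] at h2
  refine h2.congr fun n => ?_
  rw [NNReal.coe_add, exp_add_smul, map_sub, sub_add_cancel, mul_apply_eq_comp]

/-- The limit of the Taylor bound for the Yosida exponentials: the term ‖Y_n x - Ax‖ vanishes, and
‖Y_n z‖ is at most ‖Az‖. -/
lemma norm_semigroup_apply_sub_sub_le (h : IsMaximalDissipative A) (t : ℝ≥0)
    (x z : A.domain) : ‖h.semigroup t x - x - (t : ℝ) • A x‖ ≤
      (‖A z‖ * t + 2 * ‖A x - z‖) * t := by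
  have h1 := (((h.tendsto_semigroup t x).sub_const (x : E)).sub_const ((t : ℝ) • A x)).norm
  have h2 : Filter.Tendsto (fun n => (‖yosida A n x - A x‖ + ‖A z‖ * t + 2 * ‖A x - z‖) * (t : ℝ))
      Filter.atTop (𝓝 ((0 + ‖A z‖ * t + 2 * ‖A x - z‖) * (t : ℝ))) :=
    (((tendsto_iff_norm_sub_tendsto_zero.1 (h.tendsto_yosida x)).add_const _).add_const
      _).mul_const _
  rw [zero_add] at h2
  refine le_of_tendsto_of_tendsto' h1 h2 fun n => ?_
  refine (norm_exp_smul_apply_sub_sub_le (h.re_inner_yosida_nonpos n) t.2 x (A x) z).trans ?_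
  have := h.norm_yosida_le n z
  change (_ + ‖yosida A n z‖ * (t : ℝ) + _) * (t : ℝ) ≤ _
  gcongr

lemma norm_semigroup_apply_sub_le (h : IsMaximalDissipative A) (t : ℝ≥0)
    (x : A.domain) : ‖h.semigroup t x - x‖ ≤ ‖A x‖ * t := by
  refine le_of_tendsto ((h.tendsto_semigroup t x).sub_const (x : E)).norm
    (Filter.Eventually.of_forall fun n => ?_)
  refine (norm_exp_smul_apply_sub_le (h.re_inner_yosida_nonpos n) t.2 x).trans ?_
  have := h.norm_yosida_le n x
  change _ * (t : ℝ) ≤ _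
  gcongr

lemma tendsto_semigroup_nhds_zero (h : IsMaximalDissipative A) (x : E) :
    Filter.Tendsto (fun t => h.semigroup t x) (𝓝 0) (𝓝 x) := by
  refine tendsto_of_dense_of_norm_le_one (G := 1) (F := h.semigroup)
    (Filter.Eventually.of_forall h.norm_semigroup_le_one)
    ContinuousLinearMap.norm_id_le h.dense_domain (fun x hx => ?_) x
  rw [tendsto_iff_norm_sub_tendsto_zero]
  have h0 : Filter.Tendsto (fun t : ℝ≥0 => ‖A ⟨x, hx⟩‖ * (t : ℝ)) (𝓝 0) (𝓝 0) := by
    have : Continuous (fun t : ℝ≥0 => ‖A ⟨x, hx⟩‖ * (t : ℝ)) := by fun_prop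
    simpa using this.tendsto 0
  exact squeeze_zero (fun _ => norm_nonneg _)
    (fun t => h.norm_semigroup_apply_sub_le t ⟨x, hx⟩) h0

lemma isC0ContractionSemigroup (h : IsMaximalDissipative A) :
    IsC0ContractionSemigroup h.semigroup :=
  ⟨h.semigroup_zero, h.semigroup_add, h.tendsto_semigroup_nhds_zero, h.norm_semigroup_le_one⟩

lemma tendsto_inv_smul_semigroup_sub (h : IsMaximalDissipative A) (x : A.domain) :
    Filter.Tendsto (fun t : ℝ≥0 => (t : ℝ)⁻¹ • (h.semigroup t x - x)) (𝓝[>] 0) (𝓝 (A x)) := by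
  rw [Metric.tendsto_nhds]
  intro ε hε
  obtain ⟨z, hz, hxz⟩ := h.dense_domain.exists_dist_lt (A x) (by positivity : 0 < ε / 4)
  rw [dist_eq_norm] at hxz
  have h0 : Filter.Tendsto (fun t : ℝ≥0 => ‖A ⟨z, hz⟩‖ * (t : ℝ)) (𝓝[>] 0) (𝓝 0) := by
    have : Continuous (fun t : ℝ≥0 => ‖A ⟨z, hz⟩‖ * (t : ℝ)) := by fun_prop
    simpa using (this.tendsto 0).mono_left nhdsWithin_le_nhds
  filter_upwards [h0.eventually_lt_const (by positivity : 0 < ε / 2), self_mem_nhdsWithin]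
    with t ht ht0
  have ht0' : (0 : ℝ) < t := ht0
  have h1 := h.norm_semigroup_apply_sub_sub_le t x ⟨z, hz⟩
  rw [dist_eq_norm]
  have h2 : (t : ℝ)⁻¹ • (h.semigroup t x - x) - A x =
      (t : ℝ)⁻¹ • (h.semigroup t x - x - (t : ℝ) • A x) := by
    rw [smul_sub _ _ ((t : ℝ) • A x), smul_smul, inv_mul_cancel₀ ht0'.ne', one_smul]
  rw [h2, norm_smul, norm_inv, Real.norm_eq_abs, abs_of_pos ht0', inv_mul_eq_div,
    div_lt_iff₀ ht0']
  refine h1.trans_lt ?_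
  gcongr
  change _ + 2 * ‖A x - z‖ < _
  linarith

lemma isGenerator_semigroup (h : IsMaximalDissipative A) : IsGenerator A h.semigroup := by
  intro x y
  constructor
  · rintro ⟨hx, rfl⟩
    exact h.tendsto_inv_smul_semigroup_sub ⟨x, hx⟩
  intro hxy
  have hR := h.natResolvent_spec 0
  -- With y the derivative of the orbit of x at 0, solve z - Az = x - y in the domain. Then d = x -
  -- z has derivative d at 0; contractivity makes Re⟨d, d⟩ ≤ 0, so x = z.
  set z : A.domain := ⟨_, hR.mem (x - y)⟩ with hz
  have hz1 : A z = z - (x - y) := by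
    rw [hz, hR.apply_eq]
    simp
  have h1 := hxy.sub (h.tendsto_inv_smul_semigroup_sub z)
  have h2 : y - A z = x - z := by rw [hz1]; abel
  rw [h2] at h1
  have h3 : (inner ℂ (x - z) (x - z)).re ≤ 0 := by
    have h4 := (Complex.continuous_re.tendsto _).comp (h1.inner (𝕜 := ℂ)
      (tendsto_const_nhds (x := x - (z : E))))
    refine le_of_tendsto h4 ?_
    filter_upwards [self_mem_nhdsWithin] with t ht
    have ht0 : (0 : ℝ) < t := ht
    have e : (t : ℝ)⁻¹ • (h.semigroup t x - x) - (t : ℝ)⁻¹ • (h.semigroup t z - z)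
        = (t : ℝ)⁻¹ • (h.semigroup t (x - z) - (x - z)) := by
      rw [map_sub, ← smul_sub]
      congr 1
      abel
    have h5 : (inner ℂ (h.semigroup t (x - z)) (x - z)).re ≤ ‖x - (z : E)‖ * ‖x - (z : E)‖ :=
      (re_inner_le_norm (𝕜 := ℂ) _ _).trans (mul_le_mul_of_nonneg_right
        (h.norm_semigroup_apply_le t _) (norm_nonneg _))
    have h6 : (inner ℂ (x - (z : E)) (x - z)).re = ‖x - (z : E)‖ * ‖x - (z : E)‖ := by
      rw [← sq]; exact (norm_sq_eq_re_inner (𝕜 := ℂ) _).symm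
    change (inner ℂ (_ - _) _).re ≤ 0
    rw [e, RCLike.real_smul_eq_coe_smul (K := ℂ), inner_smul_left, inner_sub_left]
    change (starRingEnd ℂ (((t : ℝ)⁻¹ : ℝ) : ℂ) * _).re ≤ 0
    rw [Complex.conj_ofReal, Complex.re_ofReal_mul, Complex.sub_re, h6]
    exact mul_nonpos_of_nonneg_of_nonpos (by positivity) (by linarith)
  have h7 : x - (z : E) = 0 := by
    have h8 : (inner ℂ (x - (z : E)) (x - z)).re = ‖x - (z : E)‖ ^ 2 :=
      (norm_sq_eq_re_inner (𝕜 := ℂ) _).symm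
    rw [h8] at h3
    simpa using le_antisymm h3 (sq_nonneg _)
  rw [h7, sub_eq_zero] at h2
  rw [sub_eq_zero] at h7
  have hx : x ∈ A.domain := h7 ▸ z.2
  refine ⟨hx, ?_⟩
  rw [h2]
  exact congrArg A (Subtype.ext h7)

end IsMaximalDissipative

end Semigroup

end MGTFourier
end

noncomputable section

namespace MGTFourier

/-! ### From weak to strong differentiability. -/

section WeakDerivative

variable {E : Type*} [NormedAddCommGroup E] [InnerProductSpace ℂ E] [CompleteSpace E]

/-- A function with a continuous weak derivative is differentiable. -/
lemma hasDerivWithinAt_of_inner {f g : ℝ → E} (hg : ContinuousOn g (Set.Ici 0))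
    (h : ∀ V : E, ∀ t ∈ Set.Ici (0 : ℝ),
      HasDerivWithinAt (fun s => inner ℂ V (f s)) (inner ℂ V (g t)) (Set.Ici 0) t) :
    ∀ t ∈ Set.Ici (0 : ℝ), HasDerivWithinAt f (g t) (Set.Ici 0) t := by
  -- Freezing g at g(0) on the negative axis makes it continuous on ℝ, so the fundamental theorem of
  -- calculus applies at 0 as well. The primitive then agrees with f because every scalar product of
  -- the difference has zero derivative.
  have hc : Continuous fun t : ℝ => g (max t 0) :=
    hg.comp_continuous (by fun_prop) fun t => le_max_right t 0
  have hG (t : ℝ) : HasDerivAt (fun t => ∫ s in (0 : ℝ)..t, g (max s 0)) (g (max t 0)) t :=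
    (hc.integral_hasStrictDerivAt 0 t).hasDerivAt
  have hG' (t : ℝ) (ht : t ∈ Set.Ici (0 : ℝ)) : HasDerivWithinAt
      (fun t => f 0 + ∫ s in (0 : ℝ)..t, g (max s 0)) (g t) (Set.Ici 0) t := by
    have := ((hG t).const_add (f 0)).hasDerivWithinAt (s := Set.Ici 0)
    rwa [max_eq_left ht] at this
  have heq (t : ℝ) (ht : t ∈ Set.Ici (0 : ℝ)) :
      f t = f 0 + ∫ s in (0 : ℝ)..t, g (max s 0) := by
    refine ext_inner_left ℂ fun V => ?_
    have hd (s : ℝ) (hs : s ∈ Set.Ici (0 : ℝ)) : HasDerivWithinAt (fun s => inner ℂ V (f s) -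
        inner ℂ V (f 0 + ∫ r in (0 : ℝ)..s, g (max r 0))) 0 (Set.Ici 0) s := by
      have h1 := ((innerSL ℂ V).restrictScalars ℝ).hasFDerivAt.comp_hasDerivWithinAt s (hG' s hs)
      exact ((h V s hs).sub h1).congr_deriv (sub_self _)
    have h2 := constant_of_has_deriv_right_zero (a := 0) (b := t)
      (fun s hs => ((hd s hs.1).continuousWithinAt).mono Set.Icc_subset_Ici_self)
      (fun s hs => (hd s hs.1).mono (Set.Ici_subset_Ici.2 hs.1)) t ⟨ht, le_rfl⟩
    simp only [intervalIntegral.integral_same, add_zero, sub_self] at h2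
    exact sub_eq_zero.1 h2
  exact fun t ht => (hG' t ht).congr heq (heq t ht)

end WeakDerivative

/-! ### Graphs of the powers of an operator. -/

section Powers

variable {E : Type*} [NormedAddCommGroup E] [InnerProductSpace ℂ E] {A : E →ₗ.[ℂ] E}

lemma mem_graph_opPow_zero {x y : E} : (x, y) ∈ (opPow A 0).graph ↔ x = y := by
  rw [LinearPMap.mem_graph_iff]
  constructor
  · rintro ⟨z, hz, hz'⟩
    exact hz.symm.trans hz'
  · rintro rfl
    exact ⟨⟨x, trivial⟩, rfl, rfl⟩

lemma mem_graph_opPow_succ {n : ℕ} {x y : E} : (x, y) ∈ (opPow A (n + 1)).graph ↔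
    ∃ z, (x, z) ∈ A.graph ∧ (z, y) ∈ (opPow A n).graph := by
  constructor
  · intro h
    obtain ⟨⟨x', h1, h2⟩, rfl, h4⟩ := (LinearPMap.mem_graph_iff _).1 h
    exact ⟨A ⟨x', h1⟩, LinearPMap.mem_graph A ⟨x', h1⟩,
      (LinearPMap.mem_graph_iff _).2 ⟨⟨_, h2⟩, rfl, h4⟩⟩
  · rintro ⟨z, h1, h2⟩
    obtain ⟨x', rfl, rfl⟩ := (LinearPMap.mem_graph_iff _).1 h1
    obtain ⟨z', h3, h4⟩ := (LinearPMap.mem_graph_iff _).1 h2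
    have h3' : (z' : E) = A x' := h3
    have h5 : A x' ∈ (opPow A n).domain := h3' ▸ z'.2
    refine (LinearPMap.mem_graph_iff _).2 ⟨⟨x', x'.2, h5⟩, rfl, ?_⟩
    rw [← h4]
    exact congrArg (opPow A n) (Subtype.ext h3'.symm : (⟨A x', h5⟩ : (opPow A n).domain) = z')

/-- The definition applies A first; peeling A off last instead is what makes the domains decrease
and identifies A(Aⁿx) with Aⁿ(Ax). -/
lemma mem_graph_opPow_succ' {n : ℕ} {x y : E} : (x, y) ∈ (opPow A (n + 1)).graph ↔
    ∃ z, (x, z) ∈ (opPow A n).graph ∧ (z, y) ∈ A.graph := by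
  induction n generalizing x y with
  | zero =>
    rw [mem_graph_opPow_succ]
    constructor
    · rintro ⟨z, h1, h2⟩
      exact ⟨x, mem_graph_opPow_zero.2 rfl, mem_graph_opPow_zero.1 h2 ▸ h1⟩
    · rintro ⟨z, h1, h2⟩
      exact ⟨y, (mem_graph_opPow_zero.1 h1).symm ▸ h2, mem_graph_opPow_zero.2 rfl⟩
  | succ n ih =>
    rw [mem_graph_opPow_succ]
    constructor
    · rintro ⟨z, h1, h2⟩
      obtain ⟨w, h3, h4⟩ := ih.1 h2
      exact ⟨w, mem_graph_opPow_succ.2 ⟨z, h1, h3⟩, h4⟩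
    · rintro ⟨w, h1, h2⟩
      obtain ⟨z, h3, h4⟩ := mem_graph_opPow_succ.1 h1
      exact ⟨z, h3, ih.2 ⟨w, h4, h2⟩⟩

lemma opPow_domain_antitone : Antitone fun n => (opPow A n).domain := by
  refine antitone_nat_of_succ_le fun n x hx => ?_
  obtain ⟨z, h, -⟩ := mem_graph_opPow_succ'.1 (LinearPMap.mem_graph _ ⟨x, hx⟩)
  exact LinearPMap.mem_domain_of_mem_graph h

end Powers

/-! ### Orbits: invariance, weak solutions and regularity. -/

section Orbits

variable {E : Type*} [NormedAddCommGroup E] [InnerProductSpace ℂ E] [CompleteSpace E]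
variable {A : E →ₗ.[ℂ] E}

namespace IsMaximalDissipative

lemma semigroup_comm (h : IsMaximalDissipative A) (s t : ℝ≥0) (x : E) :
    h.semigroup s (h.semigroup t x) = h.semigroup t (h.semigroup s x) := by
  rw [← ContinuousLinearMap.comp_apply, ← ContinuousLinearMap.comp_apply, ← h.semigroup_add,
    ← h.semigroup_add, add_comm]

/-- S(t) commutes with the difference quotients of the semigroup, and their convergence
characterizes the graph of the generator. -/
lemma mem_graph_semigroup (h : IsMaximalDissipative A) (t : ℝ≥0) {x y : E}
    (hxy : (x, y) ∈ A.graph) : (h.semigroup t x, h.semigroup t y) ∈ A.graph := by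
  obtain ⟨x', rfl, rfl⟩ := (LinearPMap.mem_graph_iff _).1 hxy
  have h1 := ((h.semigroup t).continuous.tendsto _).comp (h.tendsto_inv_smul_semigroup_sub x')
  obtain ⟨h2, h3⟩ := (h.isGenerator_semigroup (h.semigroup t x') (h.semigroup t (A x'))).2
    (h1.congr fun s => by
      simp only [Function.comp_apply]
      rw [h.semigroup_comm s t, ← map_sub]
      exact ((h.semigroup t).restrictScalars ℝ).map_smul _ _)
  exact (LinearPMap.mem_graph_iff _).2 ⟨⟨_, h2⟩, rfl, h3⟩

lemma mem_graph_opPow_semigroup (h : IsMaximalDissipative A) (t : ℝ≥0) {n : ℕ} {x y : E}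
    (hxy : (x, y) ∈ (opPow A n).graph) :
    (h.semigroup t x, h.semigroup t y) ∈ (opPow A n).graph := by
  induction n generalizing x with
  | zero =>
    rw [mem_graph_opPow_zero] at hxy ⊢
    rw [hxy]
  | succ n ih =>
    obtain ⟨z, h1, h2⟩ := mem_graph_opPow_succ.1 hxy
    exact mem_graph_opPow_succ.2 ⟨_, h.mem_graph_semigroup t h1, ih h2⟩

/-- By the semigroup law and contractivity, ‖S(s)x - S(t)x‖ is at most ‖S(|s - t|)x - x‖. -/
lemma continuous_semigroup_apply (h : IsMaximalDissipative A) (x : E) :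
    Continuous fun t => h.semigroup t x := by
  have key (s r : ℝ≥0) :
      dist (h.semigroup (s + r) x) (h.semigroup s x) ≤ dist (h.semigroup r x) x := by
    rw [dist_eq_norm, dist_eq_norm, h.semigroup_add, ContinuousLinearMap.comp_apply, ← map_sub]
    exact h.norm_semigroup_apply_le s _
  have key' (s t : ℝ≥0) :
      dist (h.semigroup s x) (h.semigroup t x) ≤ dist (h.semigroup (nndist s t) x) x := by
    rcases le_total s t with hst | hst
    · obtain ⟨r, rfl⟩ := exists_add_of_le hst
      have : nndist s (s + r) = r := NNReal.eq (by simp [NNReal.dist_eq])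
      rw [this, dist_comm]
      exact key s r
    · obtain ⟨r, rfl⟩ := exists_add_of_le hst
      have : nndist (t + r) t = r := NNReal.eq (by simp [NNReal.dist_eq])
      rw [this]
      exact key t r
  rw [continuous_iff_continuousAt]
  intro t
  rw [ContinuousAt, tendsto_iff_dist_tendsto_zero]
  refine squeeze_zero (fun _ => dist_nonneg) (fun s => key' s t) ?_
  have h1 : Filter.Tendsto (fun s : ℝ≥0 => nndist s t) (𝓝 t) (𝓝 0) := by
    have : Continuous fun s : ℝ≥0 => nndist s t := by fun_prop
    simpa using this.tendsto t
  exact tendsto_iff_dist_tendsto_zero.1 ((h.tendsto_semigroup_nhds_zero x).comp h1)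

/-- The expansion at 0 is transported by the semigroup to the earlier of the two times. If t is the
later one, the derivative sits at the wrong end, which costs the extra term in S(s)Ax - S(t)Ax. -/
lemma norm_semigroup_sub_sub_le (h : IsMaximalDissipative A) (s t : ℝ≥0) (x z : A.domain) :
    ‖h.semigroup s x - h.semigroup t x - ((s : ℝ) - t) • h.semigroup t (A x)‖ ≤
      (‖A z‖ * |(s : ℝ) - t| + 2 * ‖A x - z‖ +
        ‖h.semigroup s (A x) - h.semigroup t (A x)‖) * |(s : ℝ) - t| := by
  have key (s r : ℝ≥0) : ‖h.semigroup (s + r) x - h.semigroup s x -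
      (r : ℝ) • h.semigroup s (A x)‖ ≤ (‖A z‖ * r + 2 * ‖A x - z‖) * r := by
    have e : h.semigroup (s + r) x - h.semigroup s x - (r : ℝ) • h.semigroup s (A x) =
        h.semigroup s (h.semigroup r x - x - (r : ℝ) • A x) := by
      rw [map_sub, map_sub, h.semigroup_add]
      congr 1
      exact (((h.semigroup s).restrictScalars ℝ).map_smul _ _).symm
    rw [e]
    exact (h.norm_semigroup_apply_le s _).trans (h.norm_semigroup_apply_sub_sub_le r x z)
  rcases le_total t s with hst | hst
  · obtain ⟨r, rfl⟩ := exists_add_of_le hst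
    have e : ((t + r : ℝ≥0) : ℝ) - t = r := by push_cast; ring
    rw [e, NNReal.abs_eq]
    refine (key t r).trans (mul_le_mul_of_nonneg_right ?_ r.2)
    exact le_add_of_nonneg_right (norm_nonneg _)
  · obtain ⟨r, rfl⟩ := exists_add_of_le hst
    have e : (s : ℝ) - ((s + r : ℝ≥0) : ℝ) = -r := by push_cast; ring
    rw [e, abs_neg, NNReal.abs_eq]
    have e2 : h.semigroup s x - h.semigroup (s + r) x - (-(r : ℝ)) • h.semigroup (s + r) (A x) =
        -(h.semigroup (s + r) x - h.semigroup s x - (r : ℝ) • h.semigroup s (A x)) -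
        (r : ℝ) • (h.semigroup s (A x) - h.semigroup (s + r) (A x)) := by
      rw [neg_smul, smul_sub]
      abel
    rw [e2]
    refine (norm_sub_le _ _).trans ?_
    rw [norm_neg, norm_smul, Real.norm_eq_abs, NNReal.abs_eq, add_mul _ _ (r : ℝ),
      mul_comm (r : ℝ)]
    exact add_le_add_left (key s r) _

/-- The orbits of the semigroup which start in the domain are differentiable. -/
lemma hasDerivWithinAt_semigroup (h : IsMaximalDissipative A) {x y : E}
    (hxy : (x, y) ∈ A.graph) {t : ℝ} (ht : t ∈ Set.Ici (0 : ℝ)) :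
    HasDerivWithinAt (fun s : ℝ => h.semigroup s.toNNReal x) (h.semigroup t.toNNReal y)
      (Set.Ici 0) t := by
  obtain ⟨x, rfl, rfl⟩ := (LinearPMap.mem_graph_iff _).1 hxy
  rw [hasDerivWithinAt_iff_isLittleO, Asymptotics.isLittleO_iff]
  intro ε hε
  obtain ⟨z, hz, hxz⟩ := h.dense_domain.exists_dist_lt (A x) (by positivity : 0 < ε / 4)
  rw [dist_eq_norm] at hxz
  have h0 : Filter.Tendsto (fun s : ℝ => ‖A ⟨z, hz⟩‖ * |s - t| +
      ‖h.semigroup s.toNNReal (A x) - h.semigroup t.toNNReal (A x)‖) (𝓝[Set.Ici 0] t)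
      (𝓝 0) := by
    have : Continuous (fun s : ℝ => ‖A ⟨z, hz⟩‖ * |s - t| +
        ‖h.semigroup s.toNNReal (A x) - h.semigroup t.toNNReal (A x)‖) := by
      have := (h.continuous_semigroup_apply (A x)).comp continuous_real_toNNReal
      simp only [Function.comp_def] at this
      fun_prop
    simpa using (this.tendsto t).mono_left nhdsWithin_le_nhds
  filter_upwards [h0.eventually_lt_const (by positivity : 0 < ε / 2), self_mem_nhdsWithin]
    with s hs hs0
  have h1 := h.norm_semigroup_sub_sub_le s.toNNReal t.toNNReal x ⟨z, hz⟩
  rw [Real.coe_toNNReal s hs0, Real.coe_toNNReal t ht] at h1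
  refine h1.trans ?_
  rw [Real.norm_eq_abs]
  refine mul_le_mul_of_nonneg_right ?_ (abs_nonneg _)
  change _ + 2 * ‖A x - z‖ + _ ≤ _
  linarith

lemma continuous_semigroup_toNNReal (h : IsMaximalDissipative A) (x : E) :
    Continuous fun t : ℝ => h.semigroup t.toNNReal x :=
  (h.continuous_semigroup_apply x).comp continuous_real_toNNReal

lemma isWeakSolution_semigroup (h : IsMaximalDissipative A) (x : E) :
    IsWeakSolution A x fun t => h.semigroup t.toNNReal x where
  continuousOn := (h.continuous_semigroup_toNNReal x).continuousOn
  initial := by simp [h.semigroup_zero]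
  weak V t ht := by
    -- Write x = Ay: the orbit of y is differentiable with derivative S(t)x, and A can be moved onto
    -- V.
    obtain ⟨y, hy⟩ := h.exists_mem_graph x
    have e (s : ℝ) : inner ℂ (V : E) (h.semigroup s.toNNReal x) =
        inner ℂ (A† V) (h.semigroup s.toNNReal y) := by
      obtain ⟨z, h1, h2⟩ := (LinearPMap.mem_graph_iff _).1
        (h.mem_graph_semigroup s.toNNReal hy)
      have h3 := LinearPMap.adjoint_isFormalAdjoint h.dense_domain V z
      rw [h1, h2] at h3
      exact h3.symm
    simp only [e]
    exact ((innerSL ℂ (A† V)).restrictScalars ℝ).hasFDerivAt.comp_hasDerivWithinAt t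
      (h.hasDerivWithinAt_semigroup hy ht)

lemma eqOn_of_isWeakSolution (h : IsMaximalDissipative A) {x : E} {U W : ℝ → E}
    (hU : IsWeakSolution A x U) (hW : IsWeakSolution A x W) : Set.EqOn W U (Set.Ici 0) := by
  obtain ⟨R, hR⟩ := mem_resolventSet_iff.1 h.zero_mem
  have hRA (z : A.domain) : R (A z) = -z := by
    rw [hR.apply_apply, zero_smul, zero_sub]
  have hAR (z : E) : A ⟨R z, hR.mem z⟩ = -z := by
    rw [hR.apply_eq, zero_smul, zero_sub]
  -- As R = (-A)⁻¹, its adjoint maps every V into the domain of A†, with A†R*V = -V. Testing against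
  -- R*V shows that R(W - U) has weak derivative -(W - U), which equals AR(W - U).
  have hadj (V : E) (z : A.domain) :
      inner ℂ (-V) (z : E) = inner ℂ (ContinuousLinearMap.adjoint R V) (A z) := by
    rw [ContinuousLinearMap.adjoint_inner_left, hRA, inner_neg_left, inner_neg_right]
  have hmem (V : E) : ContinuousLinearMap.adjoint R V ∈ A†.domain :=
    LinearPMap.mem_adjoint_domain_of_exists _ ⟨-V, hadj V⟩
  have hval (V : E) : A† ⟨_, hmem V⟩ = -V :=
    LinearPMap.adjoint_apply_eq h.dense_domain ⟨_, hmem V⟩ (hadj V)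
  have hd := hasDerivWithinAt_of_inner (f := fun t => R (W t - U t))
    (g := fun t => -(W t - U t)) (hW.continuousOn.sub hU.continuousOn).neg fun V t ht => by
      have h1 := (hW.weak ⟨_, hmem V⟩ t ht).sub (hU.weak ⟨_, hmem V⟩ t ht)
      rw [hval, ← inner_sub_right, inner_neg_left, ← inner_neg_right] at h1
      refine h1.congr_of_eventuallyEq (Filter.Eventually.of_forall fun s => ?_) ?_ <;>
        simp [ContinuousLinearMap.adjoint_inner_left]
  intro t ht
  have h2 := norm_le_norm_zero_of_re_inner_deriv_nonpos hd (fun s _ => by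
    have := h.isDissipative ⟨R (W s - U s), hR.mem _⟩
    rwa [hAR] at this) ht
  rw [hW.initial, hU.initial, sub_self, map_zero, norm_zero] at h2
  have h3 : R (W t - U t) = 0 := norm_le_zero_iff.1 h2
  have h4 := hAR (W t - U t)
  have h5 : (⟨R (W t - U t), hR.mem _⟩ : A.domain) = 0 := Subtype.ext h3
  rw [h5, LinearPMap.map_zero, zero_eq_neg, sub_eq_zero] at h4
  exact h4

/-- An orbit of the semigroup in the domain of `Aⁿ`, as a curve in the graph of `Aⁿ`. -/
def graphOrbit (h : IsMaximalDissipative A) {n : ℕ} {x y : E}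
    (hxy : (x, y) ∈ (opPow A n).graph) (t : ℝ) : (opPow A n).graph :=
  ⟨(h.semigroup t.toNNReal x, h.semigroup t.toNNReal y),
    h.mem_graph_opPow_semigroup t.toNNReal hxy⟩

lemma hasDerivWithinAt_graphOrbit (h : IsMaximalDissipative A) {n : ℕ} {x y x' y' : E}
    (hxy : (x, y) ∈ (opPow A n).graph) (hxy' : (x', y') ∈ (opPow A n).graph)
    (hx : (x, x') ∈ A.graph) (hy : (y, y') ∈ A.graph) {t : ℝ} (ht : t ∈ Set.Ici (0 : ℝ)) :
    HasDerivWithinAt (h.graphOrbit hxy) (h.graphOrbit hxy' t) (Set.Ici 0) t := by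
  -- The graph carries the subspace topology of E × E, so slopes converge there as soon as both
  -- components do.
  rw [hasDerivWithinAt_iff_tendsto_slope, tendsto_subtype_rng]
  exact hasDerivWithinAt_iff_tendsto_slope.1
    ((h.hasDerivWithinAt_semigroup hx ht).prodMk (h.hasDerivWithinAt_semigroup hy ht))

lemma contDiffOn_graphOrbit (h : IsMaximalDissipative A) {n m : ℕ} {x y : E}
    (hxy : (x, y) ∈ (opPow A n).graph) (hx : x ∈ (opPow A (n + m)).domain) :
    ContDiffOn ℝ m (h.graphOrbit hxy) (Set.Ici 0) := by
  induction m generalizing x y with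
  | zero =>
    refine contDiffOn_zero.2 (Continuous.continuousOn ?_)
    exact ((h.continuous_semigroup_toNNReal x).prodMk
      (h.continuous_semigroup_toNNReal y)).subtype_mk _
  | succ m ih =>
    obtain ⟨x', h1, h2⟩ := mem_graph_opPow_succ.1 (LinearPMap.mem_graph _ ⟨x, hx⟩)
    have h3 : x ∈ (opPow A (n + 1)).domain :=
      opPow_domain_antitone (by omega : n + 1 ≤ n + (m + 1)) hx
    have h4 := LinearPMap.mem_graph (opPow A (n + 1)) ⟨x, h3⟩
    obtain ⟨y₁, h5, h6⟩ := mem_graph_opPow_succ'.1 h4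
    obtain ⟨x₁, h7, h8⟩ := mem_graph_opPow_succ.1 h4
    -- Identifies the two factorizations of Aⁿ⁺¹x: the derivative of the curve through (x, Aⁿx) is
    -- the curve through (Ax, AⁿAx), to which the induction hypothesis applies.
    obtain rfl := LinearPMap.mem_graph_snd_inj _ hxy h5 rfl
    obtain rfl := LinearPMap.mem_graph_snd_inj _ h1 h7 rfl
    have hd := fun t ht => h.hasDerivWithinAt_graphOrbit hxy h8 h1 h6 (t := t) ht
    have hu := uniqueDiffOn_Ici (0 : ℝ)
    push_cast
    rw [contDiffOn_succ_iff_derivWithin hu]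
    refine ⟨fun t ht => (hd t ht).differentiableWithinAt, by simp, ?_⟩
    exact (ih h8 (LinearPMap.mem_domain_of_mem_graph h2)).congr fun t ht =>
      (hd t ht).derivWithin (hu t ht)

lemma contDiffInDomain_semigroup (h : IsMaximalDissipative A) {k j : ℕ} (hjk : j ≤ k) {x : E}
    (hx : x ∈ (opPow A k).domain) :
    ContDiffInDomain (opPow A j) (k - j) fun t => h.semigroup t.toNNReal x := by
  have h1 := LinearPMap.mem_graph (opPow A j) ⟨x, opPow_domain_antitone hjk hx⟩
  exact ⟨h.graphOrbit h1, h.contDiffOn_graphOrbit h1 (by rwa [Nat.add_sub_cancel' hjk]),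
    fun _ _ => rfl⟩

end IsMaximalDissipative

end Orbits

end MGTFourier
end

noncomputable section

namespace MGTFourier

/-! ### The operator `𝔹`: dissipativity and explicit inverse. -/

namespace System

variable {H : Type*} [NormedAddCommGroup H] [InnerProductSpace ℂ H] [CompleteSpace H]
variable (D : System H)

lemma inner_negPow_left (s : ℝ) (x y : H) :
    inner ℂ (negPow D.A s x) y = inner ℂ x (negPow D.A s y) := by
  have h : IsSelfAdjoint (negPow D.A s) := IsSelfAdjoint.of_nonneg CFC.rpow_nonneg
  nth_rewrite 1 [← h.adjoint_eq]
  exact ContinuousLinearMap.adjoint_inner_left _ _ _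

lemma negPow_comm (s t : ℝ) (x : H) :
    negPow D.A s (negPow D.A t x) = negPow D.A t (negPow D.A s x) := by
  have h : Commute (negPow D.A s) (negPow D.A t) := cfc_commute_cfc _ _ _
  exact congrArg (fun T : H →L[ℂ] H => T x) h.eq

lemma boundedInverse_apply_A (x : D.A.domain) : boundedInverse D.A (D.A x) = x :=
  D.inv_spec.left_inv x

lemma coe_eq_negPow_sqrtA (x : D.sqrtA.domain) :
    (x : H) = negPow D.A (1 / 2) (D.sqrtA x) := (D.negPow_sqrtA x).symm

lemma first_apply (U : D.PhaseSpace) : D.first U = ((D.a ^ 2 : ℝ) : ℂ) • (D.u U : H) +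
    ((D.a ^ 2 * D.β : ℝ) : ℂ) • (D.v U : H) - (D.η : ℂ) • D.powφ (D.θ U) := rfl

lemma second_apply (U : D.PhaseSpace) : D.second U = (D.η : ℂ) • D.powφ (D.v U : H) +
    ((D.α * D.η : ℝ) : ℂ) • D.powφ (D.w U) + D.θ U := rfl

lemma 𝔹_apply (U : D.𝔹.domain) : D.𝔹 U = (D.v U, ⟨D.w U, U.2.1.1⟩,
    -((D.α : ℂ)⁻¹ • (D.A ⟨D.first U, U.2.1.2⟩ + D.w U)),
    -D.A ⟨D.second U, U.2.2⟩) := rfl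

lemma isDissipative_𝔹 : IsDissipative D.𝔹 := by
  intro U
  have hα : (D.α : ℂ) ≠ 0 := by exact_mod_cast D.α_pos.ne'
  set S := negPow D.A (1 / 2) with hS
  set p := D.sqrtA (D.u U)
  set q := D.sqrtA (D.v U)
  set r := D.sqrtA ⟨D.w U, U.2.1.1⟩
  set f := D.A ⟨D.first U, U.2.1.2⟩ with hf
  set g := D.A ⟨D.second U, U.2.2⟩ with hg
  set m := q + (D.α : ℂ) • r with hm
  -- The candidate for A^{1/2}θ: θ itself is only known to lie in H, but the second domain condition
  -- gives θ = S(k).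
  set k := S g - (D.η : ℂ) • D.powφ m with hk
  have hu : (D.u U : H) = S p := D.coe_eq_negPow_sqrtA _
  have hv : (D.v U : H) = S q := D.coe_eq_negPow_sqrtA _
  have hw : D.w U = S r := D.coe_eq_negPow_sqrtA ⟨D.w U, U.2.1.1⟩
  have hSP (x : H) : D.powφ (S x) = S (D.powφ x) := D.negPow_comm _ _ _
  have hP (x y : H) : inner ℂ (D.powφ x) y = inner ℂ x (D.powφ y) := D.inner_negPow_left _ x y
  have hsq (x : H) : S (S x) = boundedInverse D.A x := D.negPow_half_sq x
  have hsecond : D.second U = S (S g) := by rw [hsq, hg, D.boundedInverse_apply_A]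
  have hfirst : D.first U = S (S f) := by rw [hsq, hf, D.boundedInverse_apply_A]
  have hθ : D.θ U = S k := by
    rw [hk, map_sub, ← hsecond, second_apply, hv, hw, hSP, hSP, hm]
    simp only [map_add, map_smul, smul_add, Complex.ofReal_mul]
    module
  -- The first domain condition with a factor A^{-1/2} cancelled. Moving A^{-1/2} across the inner
  -- product then expresses ⟨f, Sm⟩ through p, q and k alone.
  have hSf : S f = ((D.a ^ 2 : ℝ) : ℂ) • p + ((D.a ^ 2 * D.β : ℝ) : ℂ) • q -
      (D.η : ℂ) • D.powφ k := by
    apply D.negPow_half_injective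
    rw [← hS, ← hfirst, first_apply, hu, hv, hθ, hSP]
    simp only [map_add, map_sub, map_smul]
  have hSg : S g = k + (D.η : ℂ) • D.powφ m := by rw [hk]; abel
  have hthird : (D.w U : H) + (D.α : ℂ) • -((D.α : ℂ)⁻¹ • (f + D.w U)) = -f := by
    rw [smul_neg, smul_smul, mul_inv_cancel₀ hα, one_smul]; abel
  have hz : (D.v U : H) + (D.α : ℂ) • D.w U = S m := by
    rw [hv, hw, hm, map_add, map_smul]
  have e : inner ℂ (D.𝔹 U) (U : D.PhaseSpace) =
      ((D.a ^ 2 * D.α * (D.β - D.α) : ℝ) : ℂ) * inner ℂ r q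
      + ((D.a ^ 2 : ℝ) : ℂ) * inner ℂ m (p + (D.α : ℂ) • q)
      - inner ℂ (S f) m - inner ℂ (S g) k := by
    rw [inner_def]
    change _ * inner ℂ r q + _ * inner ℂ m (p + (D.α : ℂ) • q) +
      inner ℂ ((D.w U : H) + (D.α : ℂ) • -((D.α : ℂ)⁻¹ • (f + D.w U)))
        ((D.v U : H) + (D.α : ℂ) • D.w U) + inner ℂ (-g) (D.θ U) = _
    rw [hthird, hz, hθ, inner_neg_left, inner_neg_left, hS, D.inner_negPow_left,
      D.inner_negPow_left]
    ring
  have hre (x y : H) : (inner ℂ x y).re = (inner ℂ y x).re := by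
    rw [← inner_conj_symm, Complex.conj_re]
  have hnn (x : H) : (inner ℂ x x).re = ‖x‖ ^ 2 := (norm_sq_eq_re_inner (𝕜 := ℂ) x).symm
  have e2 : (inner ℂ (D.𝔹 U) (U : D.PhaseSpace)).re =
      -(D.a ^ 2 * (D.β - D.α) * ‖q‖ ^ 2) - ‖k‖ ^ 2 := by
    rw [e, hSf, hSg]
    simp only [inner_add_left, inner_sub_left, inner_add_right, inner_smul_left,
      inner_smul_right, Complex.conj_ofReal, Complex.add_re, Complex.sub_re,
      Complex.re_ofReal_mul]
    -- The two η-terms acquire the same real part with opposite signs and cancel.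
    rw [hP k m, hre k (D.powφ m), hm]
    simp only [inner_add_left, inner_add_right, inner_smul_left,
      inner_smul_right, Complex.conj_ofReal, Complex.add_re,
      Complex.re_ofReal_mul, hnn, hre q r, hre q p, hre r p]
    ring
  rw [e2]
  have h1 := sub_pos.2 D.α_lt_β
  have h2 := D.sq_pos
  have : 0 ≤ D.a ^ 2 * (D.β - D.α) * ‖q‖ ^ 2 := by positivity
  have := sq_nonneg ‖k‖
  linarith

lemma continuous_toPi_apply (i : Fin 4) : Continuous fun U => D.toPi U i :=
  (continuous_apply i).comp ((PiLp.continuous_ofLp 2 _).comp D.toPi.continuous)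

/-- The map `U ↦ A^{1/2} v`. -/
def sqrtV : D.PhaseSpace →L[ℂ] H where
  toLinearMap := D.sqrtA.toFun ∘ₗ D.v
  cont := by
    have hs : ((√(D.a ^ 2 * D.α * (D.β - D.α)) : ℝ) : ℂ) ≠ 0 := by
      exact_mod_cast (Real.sqrt_pos.2 D.coef_pos).ne'
    refine ((D.continuous_toPi_apply 0).const_smul
      (((√(D.a ^ 2 * D.α * (D.β - D.α)) : ℝ) : ℂ))⁻¹).congr fun U => ?_
    exact (inv_smul_eq_iff₀ (a := ((√(D.a ^ 2 * D.α * (D.β - D.α)) : ℝ) : ℂ))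
      (x := D.toPi U 0) (y := D.sqrtA (D.v U)) hs).2 rfl

/-- The map `U ↦ A^{1/2} u`. -/
def sqrtU : D.PhaseSpace →L[ℂ] H where
  toLinearMap := D.sqrtA.toFun ∘ₗ D.u
  cont := by
    have ha : (D.a : ℂ) ≠ 0 := by exact_mod_cast D.a_ne_zero
    refine (((D.continuous_toPi_apply 1).const_smul (D.a : ℂ)⁻¹).sub
      (D.sqrtV.continuous.const_smul (D.α : ℂ))).congr fun U => ?_
    exact sub_eq_iff_eq_add.2 ((inv_smul_eq_iff₀ (x := D.toPi U 1)
      (y := D.sqrtA (D.u U) + (D.α : ℂ) • D.sqrtA (D.v U)) ha).2 rfl)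

/-- The component `w`, as a bounded operator. -/
def wL : D.PhaseSpace →L[ℂ] H where
  toLinearMap := D.w
  cont := by
    have hα : (D.α : ℂ) ≠ 0 := by exact_mod_cast D.α_pos.ne'
    refine (((D.continuous_toPi_apply 2).sub
      ((negPow D.A (1 / 2)).continuous.comp D.sqrtV.continuous)).const_smul
      (D.α : ℂ)⁻¹).congr fun U => ?_
    have e : D.toPi U 2 - negPow D.A (1 / 2) (D.sqrtV U) = (D.α : ℂ) • D.w U := by
      change ((D.v U : H) + (D.α : ℂ) • D.w U) - negPow D.A (1 / 2) (D.sqrtA (D.v U)) = _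
      rw [D.negPow_sqrtA, add_sub_cancel_left]
    exact (inv_smul_eq_iff₀ hα).2 e

/-- The component `θ`, as a bounded operator. -/
def θL : D.PhaseSpace →L[ℂ] H where
  toLinearMap := D.θ
  cont := D.continuous_toPi_apply 3

/-- The map `(p, q, w, θ) ↦ (A^{-1/2} p, A^{-1/2} q, w, θ)`. -/
def ofCoordsₗ : (H × H × H × H) →ₗ[ℂ] D.PhaseSpace where
  toFun y := (⟨_, D.negPow_half_mem y.1⟩, ⟨_, D.negPow_half_mem y.2.1⟩, y.2.2.1, y.2.2.2)
  map_add' _ _ := D.ext_of (Subtype.ext (map_add (negPow D.A (1 / 2)) _ _))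
    (Subtype.ext (map_add (negPow D.A (1 / 2)) _ _)) rfl rfl
  map_smul' _ _ := D.ext_of (Subtype.ext (map_smul (negPow D.A (1 / 2)) _ _))
    (Subtype.ext (map_smul (negPow D.A (1 / 2)) _ _)) rfl rfl

lemma toPi_ofCoordsₗ (y : H × H × H × H) : D.toPi (D.ofCoordsₗ y) = WithLp.toLp 2
    ![((√(D.a ^ 2 * D.α * (D.β - D.α)) : ℝ) : ℂ) • y.2.1,
      (D.a : ℂ) • (y.1 + (D.α : ℂ) • y.2.1),
      negPow D.A (1 / 2) y.2.1 + (D.α : ℂ) • y.2.2.1, y.2.2.2] := by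
  have h1 : D.sqrtA (D.u (D.ofCoordsₗ y)) = y.1 := D.sqrtA_negPow y.1
  have h2 : D.sqrtA (D.v (D.ofCoordsₗ y)) = y.2.1 := D.sqrtA_negPow y.2.1
  change WithLp.toLp 2
    ![((√(D.a ^ 2 * D.α * (D.β - D.α)) : ℝ) : ℂ) • D.sqrtA (D.v (D.ofCoordsₗ y)),
      (D.a : ℂ) • (D.sqrtA (D.u (D.ofCoordsₗ y)) + (D.α : ℂ) • D.sqrtA (D.v (D.ofCoordsₗ y))),
      negPow D.A (1 / 2) y.2.1 + (D.α : ℂ) • y.2.2.1, y.2.2.2] = _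
  rw [h1, h2]

/-- The map `(p, q, w, θ) ↦ (A^{-1/2} p, A^{-1/2} q, w, θ)`, as a bounded operator. -/
def ofCoords : (H × H × H × H) →L[ℂ] D.PhaseSpace where
  toLinearMap := D.ofCoordsₗ
  cont := by
    refine D.toPi.isometry.comp_continuous_iff.1 ?_
    refine Continuous.congr ?_ fun y => (D.toPi_ofCoordsₗ y).symm
    refine (PiLp.continuous_toLp 2 _).comp (continuous_pi fun i => ?_)
    fin_cases i
    · change Continuous fun y : H × H × H × H =>
        ((√(D.a ^ 2 * D.α * (D.β - D.α)) : ℝ) : ℂ) • y.2.1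
      fun_prop
    · change Continuous fun y : H × H × H × H => (D.a : ℂ) • (y.1 + (D.α : ℂ) • y.2.1)
      fun_prop
    · change Continuous fun y : H × H × H × H =>
        negPow D.A (1 / 2) y.2.1 + (D.α : ℂ) • y.2.2.1
      fun_prop
    · change Continuous fun y : H × H × H × H => y.2.2.2
      fun_prop

/-- The map `U ↦ A^{1/2} θ'`, where `-𝔹 (u', v', w', θ') = U`. -/
def invθ : D.PhaseSpace →L[ℂ] H :=
  negPow D.A (1 / 2) ∘L D.θL + (D.η : ℂ) • (D.powφ ∘L (D.sqrtU + (D.α : ℂ) • D.sqrtV))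

/-- The operator `(-𝔹)⁻¹`. -/
def negInv𝔹 : D.PhaseSpace →L[ℂ] D.PhaseSpace :=
  D.ofCoords ∘L ((((D.a ^ 2 : ℝ) : ℂ)⁻¹ • (negPow D.A (1 / 2) ∘L
      ((D.α : ℂ) • D.wL + negPow D.A (1 / 2) ∘L D.sqrtV) + (D.η : ℂ) • (D.powφ ∘L D.invθ)) +
      (D.β : ℂ) • D.sqrtU).prod
    ((-D.sqrtU).prod ((-(negPow D.A (1 / 2) ∘L D.sqrtV)).prod
      (negPow D.A (1 / 2) ∘L D.invθ))))

lemma exists_A_eq {x y : H} (h : x = boundedInverse D.A y) :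
    ∃ hx : x ∈ D.A.domain, D.A ⟨x, hx⟩ = y := by
  subst h
  exact D.inv_spec.right_inv y

lemma A_eq_zero {x : D.A.domain} (h : D.A x = 0) : (x : H) = 0 := by
  rw [← D.boundedInverse_apply_A, h, map_zero]

lemma eq_zero_of_𝔹_eq_zero {U : D.𝔹.domain} (h : D.𝔹 U = 0) : U = 0 := by
  have hα : (D.α : ℂ) ≠ 0 := by exact_mod_cast D.α_pos.ne'
  have ha : ((D.a ^ 2 : ℝ) : ℂ) ≠ 0 := by exact_mod_cast D.sq_pos.ne'
  rw [𝔹_apply] at h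
  have hv : D.v U = 0 := congrArg D.u h
  have hw : D.w U = 0 := congrArg (fun W => (D.v W : H)) h
  have h3 : -((D.α : ℂ)⁻¹ • (D.A ⟨D.first U, U.2.1.2⟩ + D.w U)) = 0 := congrArg D.w h
  have h4 : -D.A ⟨D.second U, U.2.2⟩ = 0 := congrArg D.θ h
  rw [hw, add_zero, neg_eq_zero, smul_eq_zero_iff_right (inv_ne_zero hα)] at h3
  have h5 : D.first U = 0 := D.A_eq_zero h3
  have h6 : D.second U = 0 := D.A_eq_zero (neg_eq_zero.1 h4)
  have hθ : D.θ U = 0 := by simpa [second_apply, hv, hw] using h6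
  have hu : D.u U = 0 := by
    rw [first_apply, hv, hθ] at h5
    simpa [D.a_ne_zero] using h5
  refine Subtype.ext (D.ext_of ?_ ?_ ?_ ?_)
  · exact hu
  · exact hv
  · exact hw
  · exact hθ

/-- For F = (u, v, w, θ) the system reads v' = -u, w' = -v, with the two arguments of A equal to
A⁻¹(αw + v) and A⁻¹θ. The second gives θ', and then the first gives u'. Working with A^{1/2}u' and
A^{1/2}v' keeps the solution bounded in the phase-space norm. -/
lemma exists_𝔹_negInv𝔹 (F : D.PhaseSpace) :
    ∃ h : D.negInv𝔹 F ∈ D.𝔹.domain, D.𝔹 ⟨D.negInv𝔹 F, h⟩ = -F := by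
  have hα : (D.α : ℂ) ≠ 0 := by exact_mod_cast D.α_pos.ne'
  have ha : ((D.a ^ 2 : ℝ) : ℂ) ≠ 0 := by exact_mod_cast D.sq_pos.ne'
  set S := negPow D.A (1 / 2) with hS
  have hSP (x : H) : S (D.powφ x) = D.powφ (S x) := D.negPow_comm _ _ _
  have hsq (x : H) : S (S x) = boundedInverse D.A x := D.negPow_half_sq x
  have hu : S (D.sqrtU F) = D.u F := D.negPow_sqrtA _
  have hv : S (D.sqrtV F) = D.v F := D.negPow_sqrtA _
  have hk : S (D.invθ F) = boundedInverse D.A (D.θ F) +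
      (D.η : ℂ) • D.powφ ((D.u F : H) + (D.α : ℂ) • (D.v F : H)) := by
    change S (S (D.θ F) + (D.η : ℂ) • D.powφ (D.sqrtU F + (D.α : ℂ) • D.sqrtV F)) = _
    rw [map_add, map_smul, hSP, map_add S, map_smul S, hu, hv, hsq]
  have eu : (D.u (D.negInv𝔹 F) : H) = ((D.a ^ 2 : ℝ) : ℂ)⁻¹ •
      (boundedInverse D.A ((D.α : ℂ) • D.w F + D.v F) + (D.η : ℂ) • D.powφ (S (D.invθ F))) +
      (D.β : ℂ) • (D.u F : H) := by
    change S (((D.a ^ 2 : ℝ) : ℂ)⁻¹ • (S ((D.α : ℂ) • D.w F + S (D.sqrtV F)) +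
      (D.η : ℂ) • D.powφ (D.invθ F)) + (D.β : ℂ) • D.sqrtU F) = _
    rw [map_add, map_smul, map_add S (S _), hsq, map_smul, map_smul S, hSP, hu, hv]
  have ev : D.v (D.negInv𝔹 F) = -D.u F := by
    refine Subtype.ext ?_
    change S (-D.sqrtU F) = -(D.u F : H)
    rw [map_neg, hu]
  have ew : D.w (D.negInv𝔹 F) = -(D.v F : H) := by
    change -S (D.sqrtV F) = _
    rw [hv]
  have eθ : D.θ (D.negInv𝔹 F) = S (D.invθ F) := rfl
  have e1 : D.first (D.negInv𝔹 F) = boundedInverse D.A ((D.α : ℂ) • D.w F + D.v F) := by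
    rw [first_apply, eu, ev, eθ, smul_add, smul_inv_smul₀ ha, Complex.ofReal_mul,
      Submodule.coe_neg]
    module
  have e2 : D.second (D.negInv𝔹 F) = boundedInverse D.A (D.θ F) := by
    rw [second_apply, ev, ew, eθ, hk, Submodule.coe_neg, Complex.ofReal_mul]
    simp only [map_add, map_neg, map_smul]
    module
  obtain ⟨h1, h1'⟩ := D.exists_A_eq e1
  obtain ⟨h2, h2'⟩ := D.exists_A_eq e2
  have h3 : D.w (D.negInv𝔹 F) ∈ D.sqrtA.domain := ew ▸ (-D.v F).2
  refine ⟨⟨⟨h3, h1⟩, h2⟩, ?_⟩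
  rw [𝔹_apply]
  refine D.ext_of ?_ ?_ ?_ ?_
  · exact ev
  · exact Subtype.ext ew
  · change -((D.α : ℂ)⁻¹ • (D.A ⟨D.first (D.negInv𝔹 F), h1⟩ + D.w (D.negInv𝔹 F))) = -D.w F
    rw [h1', ew, add_neg_cancel_right, inv_smul_smul₀ hα]
  · change -D.A ⟨D.second (D.negInv𝔹 F), h2⟩ = -D.θ F
    rw [h2']

lemma isResolvent_negInv𝔹 : IsResolvent D.𝔹 0 D.negInv𝔹 where
  left_inv U := by
    -- A right inverse of an injective operator is also a left inverse.
    obtain ⟨h, h'⟩ := D.exists_𝔹_negInv𝔹 ((0 : ℂ) • (U : D.PhaseSpace) - D.𝔹 U)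
    have h0 : D.𝔹 (⟨_, h⟩ - U) = 0 := by
      rw [LinearPMap.map_sub, h', zero_smul, zero_sub, neg_neg, sub_self]
    exact congrArg Subtype.val (sub_eq_zero.1 (D.eq_zero_of_𝔹_eq_zero h0))
  right_inv F := by
    obtain ⟨h, h'⟩ := D.exists_𝔹_negInv𝔹 F
    exact ⟨h, by rw [h', zero_smul, zero_sub, neg_neg]⟩

lemma isMaximalDissipative_𝔹 : IsMaximalDissipative D.𝔹 :=
  ⟨D.isDissipative_𝔹, mem_resolventSet_iff.2 ⟨_, D.isResolvent_negInv𝔹⟩⟩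

end System

end MGTFourier

end

theorem theorem3 {H : Type*} [NormedAddCommGroup H] [InnerProductSpace ℂ H] [CompleteSpace H]
    (D : MGTFourier.System H) :
    Dense (D.𝔹.domain : Set D.PhaseSpace) ∧ MGTFourier.IsDissipative D.𝔹 ∧
    0 ∈ MGTFourier.resolventSet D.𝔹 ∧
    ∃ S : ℝ≥0 → D.PhaseSpace →L[ℂ] D.PhaseSpace,
      MGTFourier.IsC0ContractionSemigroup S ∧ MGTFourier.IsGenerator D.𝔹 S ∧
      ∀ U₀ : D.PhaseSpace, ∃ U : ℝ → D.PhaseSpace,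
        MGTFourier.IsWeakSolution D.𝔹 U₀ U ∧
        (∀ W : ℝ → D.PhaseSpace, MGTFourier.IsWeakSolution D.𝔹 U₀ W →
          Set.EqOn W U (Set.Ici 0)) ∧
        (∀ t : ℝ≥0, U t = S t U₀) ∧
        ∀ k : ℕ, U₀ ∈ (MGTFourier.opPow D.𝔹 k).domain →
          ∀ j : ℕ, j ≤ k →
            MGTFourier.ContDiffInDomain (MGTFourier.opPow D.𝔹 j) (k - j) U := by
  have h := D.isMaximalDissipative_𝔹
  refine ⟨h.dense_domain, h.isDissipative, h.zero_mem, h.semigroup, h.isC0ContractionSemigroup,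
    h.isGenerator_semigroup, fun U₀ => ⟨fun t => h.semigroup t.toNNReal U₀,
    h.isWeakSolution_semigroup U₀,
    fun W hW => h.eqOn_of_isWeakSolution (h.isWeakSolution_semigroup U₀) hW,
    fun t => congrArg (fun s => h.semigroup s U₀) Real.toNNReal_coe,
    fun k hk j hjk => h.contDiffInDomain_semigroup hjk hk⟩⟩
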